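/- Let $\mathbb{K}$ be a field of characteristic zero, let $n$ be a positive integer and $V=\{1,\dots,n\}$. For $r\ge -1$ let $C_r$ be the $\mathbb{K}$-vector space whose basis is the set of ordered partitions $[B_1,\dots,B_{r+2}]$ of $V$ into $r+2$ nonempty blocks with $1\in B_1$ (representatives of all ordered partitions modulo $(B_1,\dots,B_{r+2})\sim(-1)^{r+1}(B_2,\dots,B_{r+2},B_1)$), and for $r\ge 0$ let $\partial_r\colon C_r\to C_{r-1}$ be the linear map $$\partial_r[B_1,\dots,B_{r+2}]=\sum_{i=1}^{r+1}(-1)^{i+1}[B_1,\dots,B_i\cup B_{i+1},\dots,B_{r+2}]+(-1)^{r+3}[B_1\cup B_{r+2},B_2,\dots,B_{r+1}],$$ with $\partial_{-1}=0$. This is a chain complex $\Delta(E_n)$. For a hypergraph $H$ with vertex set $V$, the cyclic coloring complex $\Delta(H)$ is the subcomplex spanned by those $[B_1,\dots,B_{r+2}]$ in which at least one block $B_i$ contains a hyperedge of $H$; let $\Delta(H)^C=\Delta(E_n)/\Delta(H)$ be the quotient complex, and let $HC_r(\Delta(H)^C)=\ker\partial_r/\operatorname{im}\partial_{r+1}$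 be its homology. For $1\le k\le n$, call $H$ a diagonal hypergraph of rank $k$ on $n$ vertices if it is isomorphic to the hypergraph on $V$ with the $n-k+1$ hyperedges $\{1,\dots,k\},\{2,\dots,k+1\},\dots,\{n-k+1,\dots,n\}$. Theorem 5.1 (diagonal complement). Let $H$ be a diagonal hypergraph of rank $k$ on $n$ vertices with $k>\lceil n/2\rceil$. For every integer $r>n-k-1$, $$\dim_{\mathbb{K}} HC_r(\Delta(H)^C)=\binom{n-1}{r+1},$$ and for every integer $r$ with $n-k-1\ge r\ge 0$, $$\dim_{\mathbb{K}} HC_r(\Delta(H)^C)=\binom{n-1}{r+1}-(n-k)\binom{n-k-1}{r}-\binom{n-k}{r+1}.$$ -/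

import Mathlib

noncomputable section

namespace CyclicColoring

/-- An ordered partition `[B_1, ..., B_b]` of the vertex set `Fin n` into `b` nonempty blocks, whose
first block contains the first vertex. (These are the representatives of the ordered partitions up to
signed cyclic rotation.) It is given by the function sending a vertex to the position (counted
from `0`) of its block; surjectivity says that the blocks are nonempty, and the first vertex is
`0 : Fin n`. -/
structure CyclicPartition (n b : ℕ) where
  pos : Fin n → Fin b
  surjective : Function.Surjective pos
  pos_first : ∀ v : Fin n, (v : ℕ) = 0 → (pos v : ℕ) = 0

namespace CyclicPartition

variable {n b : ℕ}

/-- The block in position `j`. -/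
def block (P : CyclicPartition n b) (j : Fin b) : Set (Fin n) := {v | P.pos v = j}

/-- Effect on positions of merging the block in position `i` with the cyclically next one: for
`i < b` the blocks `i` and `i + 1` are joined; for the last position `i = b` the last block is joined
to the first one. All other blocks keep their order. -/
def mergePos (i j : Fin (b + 1)) (hb : 0 < b) : Fin b :=
  if h : (j : ℕ) ≤ i then
    if h' : (j : ℕ) = b then ⟨0, hb⟩ else ⟨j, by omega⟩
  else ⟨j - 1, by omega⟩

lemma mergePos_val (i j : Fin (b + 1)) (hb : 0 < b) :
    (mergePos i j hb : ℕ) =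
      if (j : ℕ) ≤ i then (if (j : ℕ) = b then 0 else (j : ℕ)) else (j : ℕ) - 1 := by
  unfold mergePos
  split_ifs <;> rfl

/-- `[B_1, ..., B_i ∪ B_{i+1}, ..., B_{b+2}]`, and, for the last `i`,
`[B_1 ∪ B_{b+2}, B_2, ..., B_{b+1}]`. -/
def merge (P : CyclicPartition n (b + 2)) (i : Fin (b + 2)) : CyclicPartition n (b + 1) where
  pos v := mergePos i (P.pos v) (Nat.succ_pos b)
  surjective := by
    intro y
    have : ∃ j, mergePos i j (Nat.succ_pos b) = y := by
      by_cases hy : (y : ℕ) ≤ i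
      · refine ⟨y.castSucc, ?_⟩
        ext
        have := y.isLt
        simp only [mergePos, Fin.val_castSucc]
        split_ifs <;> simp <;> omega
      · refine ⟨y.succ, ?_⟩
        ext
        simp only [mergePos, Fin.val_succ]
        split_ifs <;> simp <;> omega
    obtain ⟨j, hj⟩ := this
    obtain ⟨v, hv⟩ := P.surjective j
    exact ⟨v, by simp only [hv, hj]⟩
  pos_first v hv := by
    have h := P.pos_first v hv
    simp only [mergePos, h]
    split_ifs <;> simp

/-- Some block of `P` contains a hyperedge of `H`. -/
def HasEdge (P : CyclicPartition n b) (H : Hypergraph (Fin n)) : Prop :=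
  ∃ e ∈ H.edgeSet, ∃ j : Fin b, e ⊆ P.block j

lemma HasEdge.merge {P : CyclicPartition n (b + 2)} {H : Hypergraph (Fin n)} (h : P.HasEdge H)
    (i : Fin (b + 2)) : (P.merge i).HasEdge H := by
  obtain ⟨e, he, j, hj⟩ := h
  refine ⟨e, he, mergePos i j (Nat.succ_pos b), fun v hv => ?_⟩
  have h1 : P.pos v = j := hj hv
  change mergePos i (P.pos v) _ = _
  rw [h1]

/-- The commutation rule of the merging operations. -/
lemma merge_merge (P : CyclicPartition n (b + 3)) (i : Fin (b + 2)) (j : Fin (b + 3))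
    (hij : (j : ℕ) ≤ i) :
    (P.merge j).merge i = (P.merge i.succ).merge ⟨j, by omega⟩ := by
  have key : (fun v => mergePos i (mergePos j (P.pos v) (by omega)) (Nat.succ_pos b)) =
      fun v => mergePos ⟨j, by omega⟩ (mergePos i.succ (P.pos v) (by omega)) (Nat.succ_pos b) := by
    funext v
    ext
    have h1 := (P.pos v).isLt
    have h2 := i.isLt
    simp only [mergePos_val, Fin.val_succ]
    split_ifs <;> omega
  simp only [merge, mk.injEq]
  exact key

end CyclicPartition

open CyclicPartition

variable (𝕜 : Type*) [Field 𝕜] {n : ℕ}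

/-- The chains of the complex of all ordered partitions: the vector space on the ordered partitions
with `b` blocks. The chains of degree `r` are those with `b = r + 2` blocks. -/
abbrev Chain (n b : ℕ) : Type _ := CyclicPartition n b →₀ 𝕜

/-- The boundary map `∂_r` for `r ≥ 0`, from degree `r` to degree `r - 1`:
`∂_r [B_1, ..., B_{r+2}] = ∑_{i=1}^{r+1} (-1)^{i+1} [B_1, ..., B_i ∪ B_{i+1}, ..., B_{r+2}]
+ (-1)^{r+3} [B_1 ∪ B_{r+2}, B_2, ..., B_{r+1}]` (here with `i` counted from `0`). -/
def boundary (n r : ℕ) : Chain 𝕜 n (r + 2) →ₗ[𝕜] Chain 𝕜 n (r + 1) :=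
  Finsupp.linearCombination 𝕜 fun P : CyclicPartition n (r + 2) =>
    ∑ i : Fin (r + 2), (-1 : 𝕜) ^ (i : ℕ) • Finsupp.single (P.merge i) (1 : 𝕜)

lemma boundary_single (r : ℕ) (P : CyclicPartition n (r + 2)) :
    boundary 𝕜 n r (Finsupp.single P 1) =
      ∑ i : Fin (r + 2), (-1 : 𝕜) ^ (i : ℕ) • Finsupp.single (P.merge i) (1 : 𝕜) := by
  simp [boundary]

lemma boundary_comp_boundary (n r : ℕ) :
    boundary 𝕜 n r ∘ₗ boundary 𝕜 n (r + 1) = 0 := by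
  refine Finsupp.lhom_ext' fun P => LinearMap.ext_ring ?_
  simp only [LinearMap.comp_apply, Finsupp.lsingle_apply, LinearMap.zero_apply]
  rw [boundary_single, map_sum]
  simp only [map_smul, boundary_single, Finset.smul_sum, smul_smul, ← pow_add]
  rw [← Finset.sum_product', Finset.univ_product_univ,
    ← Finset.sum_filter_add_sum_filter_not Finset.univ
      (fun x : Fin (r + 3) × Fin (r + 2) => (x.1 : ℕ) ≤ x.2), ← eq_neg_iff_add_eq_zero,
    ← Finset.sum_neg_distrib]
  refine Finset.sum_bij'
    (fun x _ => (x.2.succ, ⟨min x.1 (r + 1), by omega⟩))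
    (fun x _ => (x.2.castSucc, ⟨x.1 - 1, by omega⟩)) ?_ ?_ ?_ ?_ ?_
  · rintro ⟨i, j⟩ h
    simp at h ⊢
    omega
  · rintro ⟨i, j⟩ h
    simp at h ⊢
    omega
  · rintro ⟨i, j⟩ h
    simp at h
    ext <;> (simp; try omega)
  · rintro ⟨i, j⟩ h
    simp at h
    ext <;> (simp; try omega)
  · rintro ⟨i, j⟩ h
    have h : (i : ℕ) ≤ j := by simpa using h
    have hm : min (i : ℕ) (r + 1) = i := by omega
    simp only [hm, Fin.val_succ, merge_merge P j i h, ← neg_smul]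
    congr 1
    ring

/-- The chains of the cyclic coloring complex `Δ(H)`: those spanned by the ordered partitions with
some block containing a hyperedge of `H`. -/
def coloringChain (H : Hypergraph (Fin n)) (b : ℕ) : Submodule 𝕜 (Chain 𝕜 n b) :=
  Submodule.span 𝕜 {x | ∃ P : CyclicPartition n b, P.HasEdge H ∧ x = Finsupp.single P 1}

lemma coloringChain_le_comap (H : Hypergraph (Fin n)) (r : ℕ) :
    coloringChain 𝕜 H (r + 2) ≤ (coloringChain 𝕜 H (r + 1)).comap (boundary 𝕜 n r) := by
  refine Submodule.span_le.2 ?_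
  rintro _ ⟨P, hP, rfl⟩
  change boundary 𝕜 n r _ ∈ coloringChain 𝕜 H (r + 1)
  rw [boundary_single]
  exact Submodule.sum_mem _ fun i _ =>
    Submodule.smul_mem _ _ (Submodule.subset_span ⟨P.merge i, hP.merge i, rfl⟩)

/-- The chains of the quotient complex `Δ(H)^C` of the complex of all ordered partitions by
`Δ(H)`. -/
abbrev ComplChain (H : Hypergraph (Fin n)) (b : ℕ) : Type _ :=
  Chain 𝕜 n b ⧸ coloringChain 𝕜 H b

/-- The boundary map `∂_r` of `Δ(H)^C`, for `r ≥ 0`. -/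
def complBoundary (H : Hypergraph (Fin n)) (r : ℕ) :
    ComplChain 𝕜 H (r + 2) →ₗ[𝕜] ComplChain 𝕜 H (r + 1) :=
  (coloringChain 𝕜 H (r + 2)).mapQ (coloringChain 𝕜 H (r + 1)) (boundary 𝕜 n r)
    (coloringChain_le_comap 𝕜 H r)

lemma range_complBoundary_le_ker (H : Hypergraph (Fin n)) (r : ℕ) :
    LinearMap.range (complBoundary 𝕜 H (r + 1)) ≤ LinearMap.ker (complBoundary 𝕜 H r) := by
  rintro _ ⟨x, rfl⟩
  obtain ⟨x, rfl⟩ := Submodule.mkQ_surjective _ x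
  have h : boundary 𝕜 n r (boundary 𝕜 n (r + 1) x) = 0 :=
    LinearMap.congr_fun (boundary_comp_boundary 𝕜 n r) x
  rw [LinearMap.mem_ker]
  simp [complBoundary, h]

/-- The homology `HC_r(Δ(H)^C) = ker ∂_r / im ∂_{r+1}`, for `r ≥ 0`. -/
abbrev ComplHomology (H : Hypergraph (Fin n)) (r : ℕ) : Type _ :=
  LinearMap.ker (complBoundary 𝕜 H r) ⧸
    (LinearMap.range (complBoundary 𝕜 H (r + 1))).submoduleOf (LinearMap.ker (complBoundary 𝕜 H r))

/-- The hypergraph on `n` vertices whose hyperedges are all the sets of `k` consecutive vertices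
`{i, i + 1, ..., i + k - 1}`. -/
def diagonal (n k : ℕ) : Hypergraph (Fin n) where
  vertexSet := Set.univ
  edgeSet := {e | ∃ i : ℕ, i + k ≤ n ∧ e = {v : Fin n | i ≤ (v : ℕ) ∧ (v : ℕ) < i + k}}
  subset_vertexSet_of_mem_edgeSet' := fun _ _ => Set.subset_univ _

/-- `H` is a diagonal hypergraph with hyperedges of size `k`: it is isomorphic to `diagonal n k`
(where `k ≤ n`, so that there are `n - k + 1 ≥ 1` hyperedges). -/
def IsDiagonal (H : Hypergraph (Fin n)) (k : ℕ) : Prop :=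
  k ≤ n ∧ ∃ σ : Equiv.Perm (Fin n), H = (diagonal n k).image σ

end CyclicColoring

end

noncomputable section

namespace CyclicColoring

/-! ### Words of block positions and cyclic merging. -/

open Finsupp

/-! An ordered partition is encoded by the word of block positions of its vertices. The quotient
complex becomes the complex of words with vertex `0` in position `0` and no edge inside a block.
Since `n < 2 * k`, all intervals of length `k` share the vertex `n - k`, so all edges share a vertex
`c`. Signed cyclic rotation moves the root from `0` to `c` without changing dimensions of cycles and
boundaries (`bd_rootMap`, `rootMap_rootMap`). Once `c` is deleted, position `0` may be empty, and a
word is inadmissible exactly when `c` together with the vertices in position `0` contains an edge.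
Admissibility is thus a hereditary condition on that one block (`hereditary_unrooted_noEdge`).

For hereditary conditions the homology is found by induction on the number of vertices
(`finrank_cycles`). A new vertex can join position `0`, or be shuffled with alternating signs
through the word as a block of its own; the first operation commutes with the boundary and the
second anticommutes (`bd_joinMap`, `bd_shuffle`). Modulo boundaries every chain is reduced, meaning
that the new vertex is in position `0` or alone (`chains_le_sup`), and a reduced chain with reduced
boundary is a join plus a shuffle (`exists_eq_joinMap_add_shuffle`). The homology therefore splits
as a direct sum, with a shift of degree for the shuffle. Iterating, there is one class in degree `p`
for each set of `p` vertices whose complement is admissible as block `0`: the vertices that were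
shuffled.

Here these are the sets of `r + 1` vertices other than `c` that meet every edge. Their number is `(n
- 1).choose (r + 1)` minus the number of sets missing some interval. The latter are sorted by the
first interval missed (`card_missingSets`). -/

/-- The effect on positions of merging the blocks in the cyclically consecutive positions `i` and
`i + 1`, when the positions are `0, ..., p`. -/
def face (p i j : ℕ) : ℕ := if j ≤ i then (if j = p then 0 else j) else j - 1

/-- The increasing map of positions which omits the value `j`. -/
def gap (j x : ℕ) : ℕ := if x < j then x else x + 1

/-- `f` takes values in `{0, ..., p}`, and every position, except perhaps `0`, is attained. -/
def IsCell {α : Type*} (p : ℕ) (f : α → ℕ) : Prop :=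
  (∀ v, f v ≤ p) ∧ ∀ j, 1 ≤ j → j ≤ p → ∃ v, f v = j

/-- The admissible cells with positions `0, ..., p`. -/
def cells {α : Type*} (G : (α → ℕ) → Prop) (p : ℕ) : Set (α → ℕ) := {f | IsCell p f ∧ G f}

/-- A predicate that only becomes truer when vertices leave the block in position `0`. -/
def Hereditary {α : Type*} (G : (α → ℕ) → Prop) : Prop :=
  ∀ f f' : α → ℕ, (∀ v, f v = 0 → f' v = 0) → G f' → G f

/-- A predicate whose failure is preserved by merging blocks. -/
def FaceStable {α : Type*} (G : (α → ℕ) → Prop) : Prop :=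
  ∀ p i f, G (face p i ∘ f) → G f

lemma face_zero (p i : ℕ) : face p i 0 = 0 := by
  unfold face; split_ifs <;> omega

/-- Merging never takes a vertex out of position `0`. -/
lemma Hereditary.faceStable {α : Type*} {G : (α → ℕ) → Prop} (hG : Hereditary G) :
    FaceStable G := fun p i f h => hG _ _ (fun v hv => by simp [hv, face_zero]) h

lemma face_face {p i j x : ℕ} (hij : j ≤ i) (hi : i ≤ p + 1) (hx : x ≤ p + 2) :
    face (p + 1) i (face (p + 2) j x) = face (p + 1) j (face (p + 2) (i + 1) x) := by
  unfold face; split_ifs <;> omega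

lemma IsCell.face {α : Type*} {p i : ℕ} {f : α → ℕ} (hf : IsCell (p + 1) f) :
    IsCell p (face (p + 1) i ∘ f) := by
  refine ⟨fun v => ?_, fun j h1 h2 => ?_⟩
  · have := hf.1 v
    simp only [Function.comp, CyclicColoring.face]
    split_ifs <;> omega
  · by_cases h : j ≤ i
    · obtain ⟨v, hv⟩ := hf.2 j h1 (by omega)
      refine ⟨v, ?_⟩
      simp only [Function.comp, CyclicColoring.face, hv]
      split_ifs <;> omega
    · obtain ⟨v, hv⟩ := hf.2 (j + 1) (by omega) (by omega)
      refine ⟨v, ?_⟩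
      simp only [Function.comp, CyclicColoring.face, hv]
      split_ifs <;> omega

/-! ### The chain complex of admissible words. -/

section Complex

variable (𝕜 : Type*) [Field 𝕜] {α : Type*} (G : (α → ℕ) → Prop)

open Classical in
/-- The basis vector of an admissible word, and zero for the other words. -/
def term (f : α → ℕ) : (α → ℕ) →₀ 𝕜 := if G f then single f 1 else 0

variable {G} in
lemma term_of {f : α → ℕ} (h : G f) : term 𝕜 G f = single f 1 := if_pos h

variable {G} in
lemma term_of_not {f : α → ℕ} (h : ¬ G f) : term 𝕜 G f = 0 := if_neg h

/-- The map on words induced by merging the positions `i` and `i + 1`. -/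
def faceMap (p i : ℕ) : ((α → ℕ) →₀ 𝕜) →ₗ[𝕜] ((α → ℕ) →₀ 𝕜) :=
  linearCombination 𝕜 fun f => term 𝕜 G (face p i ∘ f)

/-- The boundary map from degree `p`. -/
def bd (p : ℕ) : ((α → ℕ) →₀ 𝕜) →ₗ[𝕜] ((α → ℕ) →₀ 𝕜) :=
  ∑ i ∈ Finset.range (p + 1), (-1 : 𝕜) ^ i • faceMap 𝕜 G p i

/-- The chains of degree `p`. -/
def chains (p : ℕ) : Submodule 𝕜 ((α → ℕ) →₀ 𝕜) := supported 𝕜 𝕜 (cells G p)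

/-- The cycles of degree `p`. -/
def cycles : ℕ → Submodule 𝕜 ((α → ℕ) →₀ 𝕜)
  | 0 => chains 𝕜 G 0
  | p + 1 => chains 𝕜 G (p + 1) ⊓ LinearMap.ker (bd 𝕜 G (p + 1))

/-- The boundaries of degree `p`. -/
def boundaries (p : ℕ) : Submodule 𝕜 ((α → ℕ) →₀ 𝕜) :=
  (chains 𝕜 G (p + 1)).map (bd 𝕜 G (p + 1))

lemma faceMap_single (p i : ℕ) (f : α → ℕ) :
    faceMap 𝕜 G p i (single f 1) = term 𝕜 G (face p i ∘ f) := by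
  simp [faceMap]

lemma bd_apply (p : ℕ) (x : (α → ℕ) →₀ 𝕜) :
    bd 𝕜 G p x = ∑ i ∈ Finset.range (p + 1), (-1 : 𝕜) ^ i • faceMap 𝕜 G p i x := by
  simp [bd, LinearMap.sum_apply]

lemma bd_single (p : ℕ) (f : α → ℕ) :
    bd 𝕜 G p (single f 1) =
      ∑ i ∈ Finset.range (p + 1), (-1 : 𝕜) ^ i • term 𝕜 G (face p i ∘ f) := by
  simp [bd_apply, faceMap_single]

variable {𝕜} {G}

lemma chains_le {p : ℕ} {P : Submodule 𝕜 ((α → ℕ) →₀ 𝕜)}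
    (h : ∀ f ∈ cells G p, single f 1 ∈ P) : chains 𝕜 G p ≤ P := by
  rw [chains, supported_eq_span_single, Submodule.span_le]
  rintro _ ⟨f, hf, rfl⟩
  exact h f hf

lemma eqOn_chains {p : ℕ} {M : Type*} [AddCommGroup M] [Module 𝕜 M]
    {φ ψ : ((α → ℕ) →₀ 𝕜) →ₗ[𝕜] M} (h : ∀ f ∈ cells G p, φ (single f 1) = ψ (single f 1))
    {x : (α → ℕ) →₀ 𝕜} (hx : x ∈ chains 𝕜 G p) : φ x = ψ x :=
  by
  have : chains 𝕜 G p ≤ LinearMap.eqLocus φ ψ := chains_le h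
  exact this hx

lemma single_mem_chains {p : ℕ} {f : α → ℕ} (hf : f ∈ cells G p) :
    single f (1 : 𝕜) ∈ chains 𝕜 G p := single_mem_supported 𝕜 1 hf

lemma term_mem_chains {p : ℕ} {f : α → ℕ} (hf : IsCell p f) : term 𝕜 G f ∈ chains 𝕜 G p := by
  by_cases h : G f
  · rw [term_of 𝕜 h]; exact single_mem_chains ⟨hf, h⟩
  · rw [term_of_not 𝕜 h]; exact zero_mem _

/-- An inadmissible word has no admissible face, so discarding it before or after merging makes no
difference. -/
lemma faceMap_term (hG : FaceStable G) (p i : ℕ) (f : α → ℕ) :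
    faceMap 𝕜 G p i (term 𝕜 G f) = term 𝕜 G (face p i ∘ f) := by
  by_cases h : G f
  · rw [term_of 𝕜 h, faceMap_single]
  · rw [term_of_not 𝕜 h, term_of_not 𝕜 (fun h' => h (hG _ _ _ h')), map_zero]

lemma bd_mem_chains {p : ℕ} {x : (α → ℕ) →₀ 𝕜} (hx : x ∈ chains 𝕜 G (p + 1)) :
    bd 𝕜 G (p + 1) x ∈ chains 𝕜 G p := by
  suffices h : chains 𝕜 G (p + 1) ≤ (chains 𝕜 G p).comap (bd 𝕜 G (p + 1)) from h hx
  refine chains_le fun f hf => ?_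
  rw [Submodule.mem_comap, bd_single]
  exact Submodule.sum_mem _ fun i _ => Submodule.smul_mem _ _ (term_mem_chains hf.1.face)

lemma bd_bd (hG : FaceStable G) {p : ℕ} {x : (α → ℕ) →₀ 𝕜} (hx : x ∈ chains 𝕜 G (p + 2)) :
    bd 𝕜 G (p + 1) (bd 𝕜 G (p + 2) x) = 0 := by
  refine eqOn_chains (φ := bd 𝕜 G (p + 1) ∘ₗ bd 𝕜 G (p + 2)) (ψ := 0) (fun f hf => ?_) hx
  simp only [LinearMap.comp_apply, bd_single, map_sum, map_smul, LinearMap.zero_apply]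
  simp only [bd_apply, faceMap_term hG, Finset.smul_sum, smul_smul, ← pow_add]
  rw [← Finset.sum_product', ← Finset.sum_filter_add_sum_filter_not _
    (fun x : ℕ × ℕ => x.1 ≤ x.2), ← eq_neg_iff_add_eq_zero, ← Finset.sum_neg_distrib]
  -- Merging at `i` and then at `j`, with `i ≤ j`, cancels against merging at `j + 1` and then at
  -- `i`.
  refine Finset.sum_bij' (fun x _ => (x.2 + 1, x.1)) (fun x _ => (x.2, x.1 - 1)) ?_ ?_ ?_ ?_ ?_
  · rintro ⟨i, j⟩ h
    simp at h ⊢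
    omega
  · rintro ⟨i, j⟩ h
    simp at h ⊢
    omega
  · rintro ⟨i, j⟩ h
    simp
  · rintro ⟨i, j⟩ h
    simp at h ⊢
    omega
  · rintro ⟨i, j⟩ h
    simp at h
    have : face (p + 1) j ∘ face (p + 2) i ∘ f = face (p + 1) i ∘ face (p + 2) (j + 1) ∘ f := by
      funext v
      exact face_face h.2 (by omega) (hf.1.1 v)
    simp only [this, ← neg_smul]
    congr 1
    ring

lemma boundaries_le_cycles (hG : FaceStable G) (p : ℕ) : boundaries 𝕜 G p ≤ cycles 𝕜 G p := by
  rintro _ ⟨x, hx, rfl⟩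
  cases p with
  | zero => exact bd_mem_chains hx
  | succ p => exact ⟨bd_mem_chains hx, bd_bd hG hx⟩

lemma finite_cells [Finite α] (p : ℕ) : (cells G p).Finite := by
  refine (Set.Finite.pi' (t := fun _ : α => Set.Iic p) fun _ => Set.finite_Iic p).subset ?_
  exact fun f hf v => hf.1.1 v

instance finiteDimensional_chains [Finite α] (p : ℕ) : FiniteDimensional 𝕜 (chains 𝕜 G p) := by
  have := (finite_cells (G := G) p).to_subtype
  exact Module.Finite.equiv (supportedEquivFinsupp (R := 𝕜) (M := 𝕜) (cells G p)).symm

lemma cycles_le_chains (p : ℕ) : cycles 𝕜 G p ≤ chains 𝕜 G p := by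
  cases p with
  | zero => exact le_rfl
  | succ p => exact inf_le_left

instance finiteDimensional_cycles [Finite α] (p : ℕ) : FiniteDimensional 𝕜 (cycles 𝕜 G p) :=
  Submodule.finiteDimensional_of_le (cycles_le_chains p)

instance finiteDimensional_boundaries [Finite α] (p : ℕ) :
    FiniteDimensional 𝕜 (boundaries 𝕜 G p) := by
  unfold boundaries; infer_instance

end Complex

/-! ### Adding one vertex to a word. -/

section Words

variable {N : ℕ}

/-- The word in which the new vertex `0` is put into the block in position `j`. -/
def consWord (j : ℕ) (g : Fin N → ℕ) : Fin (N + 1) → ℕ := Fin.cons j g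

/-- The word in which the new vertex `0` becomes a block of its own in position `j + 1`. -/
def insWord (j : ℕ) (g : Fin N → ℕ) : Fin (N + 1) → ℕ := consWord (j + 1) (gap (j + 1) ∘ g)

@[simp] lemma consWord_zero (j : ℕ) (g : Fin N → ℕ) : consWord j g 0 = j := rfl

@[simp] lemma consWord_succ (j : ℕ) (g : Fin N → ℕ) (v : Fin N) :
    consWord j g v.succ = g v := rfl

@[simp] lemma insWord_zero (j : ℕ) (g : Fin N → ℕ) : insWord j g 0 = j + 1 := rfl

@[simp] lemma insWord_succ (j : ℕ) (g : Fin N → ℕ) (v : Fin N) :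
    insWord j g v.succ = gap (j + 1) (g v) := rfl

lemma consWord_inj {j j' : ℕ} {g g' : Fin N → ℕ} (h : consWord j g = consWord j' g') :
    j = j' ∧ g = g' := Fin.cons_inj.1 h

lemma consWord_injective (j : ℕ) : Function.Injective (consWord (N := N) j) :=
  fun _ _ h => (consWord_inj h).2

lemma gap_injective (j : ℕ) : Function.Injective (gap j) := by
  intro x y h
  unfold gap at h
  split_ifs at h <;> omega

lemma gap_ne (j x : ℕ) : gap j x ≠ j := by
  unfold gap; split_ifs <;> omega

lemma insWord_injective (j : ℕ) : Function.Injective (insWord (N := N) j) := fun g g' h => by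
  have := (consWord_inj h).2
  funext v
  exact gap_injective _ (congrFun this v)

lemma comp_consWord (φ : ℕ → ℕ) (j : ℕ) (g : Fin N → ℕ) :
    φ ∘ consWord j g = consWord (φ j) (φ ∘ g) := by
  funext v
  refine Fin.cases rfl (fun v => rfl) v

lemma isCell_consWord_zero {p : ℕ} {g : Fin N → ℕ} :
    IsCell p (consWord 0 g) ↔ IsCell p g := by
  simp only [IsCell, Fin.forall_fin_succ, Fin.exists_fin_succ, consWord_zero, consWord_succ]
  refine ⟨fun h => ⟨h.1.2, fun j h1 h2 => (h.2 j h1 h2).resolve_left (by omega)⟩,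
    fun h => ⟨⟨zero_le, h.1⟩, fun j h1 h2 => Or.inr (h.2 j h1 h2)⟩⟩

lemma IsCell.consWord {p j : ℕ} {g : Fin N → ℕ} (hg : IsCell p g) (hj : j ≤ p) :
    IsCell p (consWord j g) := by
  simp only [IsCell, Fin.forall_fin_succ, Fin.exists_fin_succ, consWord_zero, consWord_succ]
  exact ⟨⟨hj, hg.1⟩, fun j h1 h2 => Or.inr (hg.2 j h1 h2)⟩

lemma IsCell.insWord {q j : ℕ} {g : Fin N → ℕ} (hg : IsCell q g) (hj : j ≤ q) :
    IsCell (q + 1) (insWord j g) := by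
  simp only [IsCell, Fin.forall_fin_succ, Fin.exists_fin_succ, insWord_zero, insWord_succ]
  refine ⟨⟨by omega, fun v => ?_⟩, fun i h1 h2 => ?_⟩
  · have := hg.1 v
    unfold gap; split_ifs <;> omega
  · rcases lt_trichotomy i (j + 1) with h | h | h
    · obtain ⟨v, hv⟩ := hg.2 i h1 (by omega)
      exact Or.inr ⟨v, by simp [gap, hv, h]⟩
    · exact Or.inl h.symm
    · obtain ⟨v, hv⟩ := hg.2 (i - 1) (by omega) (by omega)
      refine Or.inr ⟨v, ?_⟩
      rw [hv]; unfold gap; split_ifs <;> omega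

/-- The new vertex is alone in its block, so deleting it frees a position, and closing the gap
recovers `g'`. -/
lemma exists_insWord {p j : ℕ} {g : Fin N → ℕ} (h : IsCell p (consWord (j + 1) g))
    (hj : ∀ v, g v ≠ j + 1) :
    ∃ q g', p = q + 1 ∧ j ≤ q ∧ IsCell q g' ∧ consWord (j + 1) g = insWord j g' := by
  simp only [IsCell, Fin.forall_fin_succ, Fin.exists_fin_succ, consWord_zero,
    consWord_succ] at h
  obtain ⟨⟨h1, h2⟩, h3⟩ := h
  obtain ⟨q, rfl⟩ : ∃ q, p = q + 1 := ⟨p - 1, by omega⟩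
  refine ⟨q, fun v => if g v ≤ j then g v else g v - 1, rfl, by omega, ⟨fun v => ?_, ?_⟩, ?_⟩
  · have := h2 v
    dsimp only
    split_ifs <;> omega
  · intro i hi hi'
    by_cases hij : i ≤ j
    · obtain ⟨v, hv⟩ := (h3 i hi (by omega)).resolve_left (by omega)
      exact ⟨v, by simp [hv, hij]⟩
    · obtain ⟨v, hv⟩ := (h3 (i + 1) (by omega) (by omega)).resolve_left (by omega)
      refine ⟨v, ?_⟩
      dsimp only
      rw [hv]; split_ifs <;> omega
  · unfold insWord
    congr 1
    funext v
    have := hj v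
    simp only [Function.comp, gap]
    split_ifs <;> omega

lemma face_insWord_lt {q j i : ℕ} {g : Fin N → ℕ} (hg : ∀ v, g v ≤ q) (hj : j ≤ q) (hi : i < j) :
    face (q + 1) i ∘ insWord j g = insWord (j - 1) (face q i ∘ g) := by
  unfold insWord
  rw [comp_consWord]
  congr 1
  · unfold face; split_ifs <;> omega
  · funext v
    have := hg v
    simp only [Function.comp, face, gap]
    split_ifs <;> omega

lemma face_insWord_left {q j : ℕ} {g : Fin N → ℕ} (hg : ∀ v, g v ≤ q) :
    face (q + 1) j ∘ insWord j g = consWord j g := by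
  unfold insWord
  rw [comp_consWord]
  congr 1
  · unfold face; split_ifs <;> omega
  · funext v
    have := hg v
    simp only [Function.comp, face, gap]
    split_ifs <;> omega

/-- The singleton is absorbed by its cyclic successor, which is the block in position `0` when the
singleton is last. -/
lemma face_insWord_right {q j : ℕ} {g : Fin N → ℕ} (hg : ∀ v, g v ≤ q) :
    face (q + 1) (j + 1) ∘ insWord j g = consWord (if j = q then 0 else j + 1) g := by
  unfold insWord
  rw [comp_consWord]
  congr 1
  · unfold face; split_ifs <;> omega
  · funext v
    have := hg v
    simp only [Function.comp, face, gap]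
    split_ifs <;> omega

lemma face_insWord_gt {q j i : ℕ} {g : Fin N → ℕ} (hg : ∀ v, g v ≤ q) (hi : j < i) (hiq : i ≤ q) :
    face (q + 1) (i + 1) ∘ insWord j g = insWord j (face q i ∘ g) := by
  unfold insWord
  rw [comp_consWord]
  congr 1
  · unfold face; split_ifs <;> omega
  · funext v
    have := hg v
    simp only [Function.comp, face, gap]
    split_ifs <;> omega

end Words

/-! ### Joining, inserting and shuffling a vertex. -/

section Step

variable (𝕜 : Type*) [Field 𝕜] {N : ℕ} (G : (Fin (N + 1) → ℕ) → Prop)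

/-- The predicate on words for the new vertex in the block in position `0`. -/
def inZero (g : Fin N → ℕ) : Prop := G (consWord 0 g)

/-- The predicate on words for the new vertex outside the block in position `0`. -/
def offZero (g : Fin N → ℕ) : Prop := G (consWord 1 g)

variable {G}

lemma Hereditary.inZero (hG : Hereditary G) : Hereditary (inZero G) := fun _ _ h hf =>
  hG _ _ (Fin.cases (fun _ => rfl) h) hf

lemma Hereditary.offZero (hG : Hereditary G) : Hereditary (offZero G) := fun _ _ h hf =>
  hG _ _ (Fin.cases id h) hf

lemma Hereditary.iff_of_zero (hG : Hereditary G) {f f' : Fin (N + 1) → ℕ}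
    (h : ∀ v, f v = 0 ↔ f' v = 0) : G f ↔ G f' :=
  ⟨hG _ _ fun v => (h v).2, hG _ _ fun v => (h v).1⟩

lemma Hereditary.consWord_iff (hG : Hereditary G) {j : ℕ} (hj : j ≠ 0) (g : Fin N → ℕ) :
    G (consWord j g) ↔ CyclicColoring.offZero G g :=
  hG.iff_of_zero (Fin.cases (by simp [hj]) (by simp))

/-- A gap opened at a positive position leaves the zero set alone, and a hereditary predicate sees
nothing else. -/
lemma Hereditary.insWord_iff (hG : Hereditary G) (j : ℕ) (g : Fin N → ℕ) :
    G (insWord j g) ↔ CyclicColoring.offZero G g :=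
  hG.iff_of_zero (Fin.cases (by simp) fun v => by
    have h : gap (j + 1) (g v) = 0 ↔ g v = 0 := by
      by_cases h : g v < j + 1
      · simp [gap, h]
      · simp [gap, h]; omega
    simpa using h)

/-- Put the new vertex into the block in position `0`. -/
def joinMap : ((Fin N → ℕ) →₀ 𝕜) →ₗ[𝕜] ((Fin (N + 1) → ℕ) →₀ 𝕜) :=
  lmapDomain 𝕜 𝕜 (consWord 0)

/-- Make the new vertex a block of its own in position `j + 1`. -/
def insMap (j : ℕ) : ((Fin N → ℕ) →₀ 𝕜) →ₗ[𝕜] ((Fin (N + 1) → ℕ) →₀ 𝕜) :=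
  lmapDomain 𝕜 𝕜 (insWord j)

variable (G) in
/-- Put the new vertex into the block in position `j`. -/
def consMap (j : ℕ) : ((Fin N → ℕ) →₀ 𝕜) →ₗ[𝕜] ((Fin (N + 1) → ℕ) →₀ 𝕜) :=
  linearCombination 𝕜 fun g => term 𝕜 G (consWord j g)

/-- The signed shuffle of the new vertex with words with positions `0, ..., p - 1`. -/
def shuffle (p : ℕ) : ((Fin N → ℕ) →₀ 𝕜) →ₗ[𝕜] ((Fin (N + 1) → ℕ) →₀ 𝕜) :=
  ∑ j ∈ Finset.range p, (-1 : 𝕜) ^ j • insMap 𝕜 j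

lemma shuffle_apply (p : ℕ) (x : (Fin N → ℕ) →₀ 𝕜) :
    shuffle 𝕜 p x = ∑ j ∈ Finset.range p, (-1 : 𝕜) ^ j • insMap 𝕜 j x := by
  simp [shuffle, LinearMap.sum_apply]

@[simp] lemma joinMap_single (g : Fin N → ℕ) :
    joinMap 𝕜 (single g 1) = single (consWord 0 g) 1 := by
  simp [joinMap]

@[simp] lemma insMap_single (j : ℕ) (g : Fin N → ℕ) :
    insMap 𝕜 j (single g 1) = single (insWord j g) 1 := by
  simp [insMap]

@[simp] lemma consMap_single (j : ℕ) (g : Fin N → ℕ) :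
    consMap 𝕜 G j (single g 1) = term 𝕜 G (consWord j g) := by
  simp [consMap]

lemma term_consWord_zero (g : Fin N → ℕ) :
    term 𝕜 G (consWord 0 g) = joinMap 𝕜 (term 𝕜 (inZero G) g) := by
  by_cases h : G (consWord 0 g)
  · rw [term_of 𝕜 h, term_of 𝕜 (G := inZero G) h, joinMap_single]
  · rw [term_of_not 𝕜 h, term_of_not 𝕜 (G := inZero G) h, map_zero]

lemma term_insWord (hG : Hereditary G) (j : ℕ) (g : Fin N → ℕ) :
    term 𝕜 G (insWord j g) = insMap 𝕜 j (term 𝕜 (offZero G) g) := by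
  by_cases h : offZero G g
  · rw [term_of 𝕜 h, term_of 𝕜 ((hG.insWord_iff j g).2 h), insMap_single]
  · rw [term_of_not 𝕜 h, term_of_not 𝕜 (fun h' => h ((hG.insWord_iff j g).1 h')), map_zero]

variable {𝕜}

lemma bd_joinMap (p : ℕ) (x : (Fin N → ℕ) →₀ 𝕜) :
    bd 𝕜 G p (joinMap 𝕜 x) = joinMap 𝕜 (bd 𝕜 (inZero G) p x) := by
  suffices bd 𝕜 G p ∘ₗ joinMap 𝕜 = joinMap 𝕜 ∘ₗ bd 𝕜 (inZero G) p from
    LinearMap.congr_fun this x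
  refine lhom_ext' fun g => LinearMap.ext_ring ?_
  simp only [LinearMap.comp_apply, lsingle_apply, joinMap_single, bd_single, map_sum, map_smul,
    comp_consWord, face_zero, term_consWord_zero]

/-- The faces are sorted relative to the inserted singleton: `j` before it, two that absorb it into
a neighbour, `l` after it. The last group is shifted by one index, whence the minus sign. -/
lemma bd_insMap (hG : Hereditary G) (j l : ℕ) {x : (Fin N → ℕ) →₀ 𝕜}
    (hx : x ∈ chains 𝕜 (offZero G) (j + l)) :
    bd 𝕜 G (j + l + 1) (insMap 𝕜 j x) =
      ∑ i ∈ Finset.range j, (-1 : 𝕜) ^ i • insMap 𝕜 (j - 1) (faceMap 𝕜 (offZero G) (j + l) i x)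
      + (-1 : 𝕜) ^ j • consMap 𝕜 G j x
      + (-1 : 𝕜) ^ (j + 1) • consMap 𝕜 G (if l = 0 then 0 else j + 1) x
      - ∑ i ∈ Finset.range l,
        (-1 : 𝕜) ^ (j + 1 + i) • insMap 𝕜 j (faceMap 𝕜 (offZero G) (j + l) (j + 1 + i) x) := by
  let ψ : ((Fin N → ℕ) →₀ 𝕜) →ₗ[𝕜] ((Fin (N + 1) → ℕ) →₀ 𝕜) :=
    ∑ i ∈ Finset.range j, (-1 : 𝕜) ^ i • insMap 𝕜 (j - 1) ∘ₗ faceMap 𝕜 (offZero G) (j + l) i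
      + (-1 : 𝕜) ^ j • consMap 𝕜 G j
      + (-1 : 𝕜) ^ (j + 1) • consMap 𝕜 G (if l = 0 then 0 else j + 1)
      - ∑ i ∈ Finset.range l,
        (-1 : 𝕜) ^ (j + 1 + i) • insMap 𝕜 j ∘ₗ faceMap 𝕜 (offZero G) (j + l) (j + 1 + i)
  have key := eqOn_chains (φ := bd 𝕜 G (j + l + 1) ∘ₗ insMap 𝕜 j) (ψ := ψ) ?_ hx
  · simpa [ψ, LinearMap.sum_apply] using key
  rintro g ⟨⟨hg, -⟩, -⟩
  simp only [ψ, LinearMap.comp_apply, LinearMap.sub_apply, LinearMap.add_apply,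
    LinearMap.sum_apply, LinearMap.smul_apply, insMap_single, bd_single, faceMap_single,
    consMap_single]
  rw [show j + l + 1 + 1 = j + 1 + 1 + l by omega, Finset.sum_range_add, Finset.sum_range_succ,
    Finset.sum_range_succ, face_insWord_left hg, face_insWord_right hg,
    sub_eq_add_neg, ← Finset.sum_neg_distrib]
  have h0 : (j = j + l) = (l = 0) := by simp
  simp only [h0]
  congr 1
  · congr 2
    refine Finset.sum_congr rfl fun i hi => ?_
    rw [face_insWord_lt hg (by omega) (Finset.mem_range.1 hi), term_insWord 𝕜 hG]
  · refine Finset.sum_congr rfl fun i hi => ?_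
    have := Finset.mem_range.1 hi
    rw [show j + 1 + 1 + i = j + 1 + i + 1 by omega, face_insWord_gt hg (by omega) (by omega),
      term_insWord 𝕜 hG, ← neg_smul]
    congr 1
    ring

end Step

/-! ### Splitting the homology along one vertex. -/

section Decomposition

variable {𝕜 : Type*} [Field 𝕜] {N : ℕ} {G : (Fin (N + 1) → ℕ) → Prop}

lemma joinMap_apply_of_ne {h : Fin (N + 1) → ℕ} (h0 : h 0 ≠ 0) (x : (Fin N → ℕ) →₀ 𝕜) :
    joinMap 𝕜 x h = 0 :=
  mapDomain_of_notMem_range _ _ fun ⟨_, hg⟩ => h0 (hg ▸ rfl)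

lemma insMap_apply_of_ne {j : ℕ} {h : Fin (N + 1) → ℕ} (h0 : h 0 ≠ j + 1)
    (x : (Fin N → ℕ) →₀ 𝕜) : insMap 𝕜 j x h = 0 :=
  mapDomain_of_notMem_range _ _ fun ⟨_, hg⟩ => h0 (hg ▸ rfl)

lemma insMap_apply_of_eq {j : ℕ} {h : Fin (N + 1) → ℕ} {v : Fin N} (hv : h v.succ = h 0)
    (x : (Fin N → ℕ) →₀ 𝕜) : insMap 𝕜 j x h = 0 :=
  mapDomain_of_notMem_range _ _ fun ⟨g, hg⟩ => gap_ne (j + 1) (g v) (by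
    rw [← hg] at hv; exact hv)

lemma shuffle_apply_of_eq {p : ℕ} {h : Fin (N + 1) → ℕ} (h0 : h 0 = 0)
    (x : (Fin N → ℕ) →₀ 𝕜) : shuffle 𝕜 p x h = 0 := by
  rw [shuffle_apply, finsetSum_apply]
  exact Finset.sum_eq_zero fun j _ => by
    rw [Finsupp.smul_apply, insMap_apply_of_ne (by omega), smul_zero]

lemma joinMap_injective : Function.Injective (joinMap 𝕜 (N := N)) :=
  mapDomain_injective (consWord_injective 0)

/-- Only the summand `j = 0` has the new vertex in position `1`, so the coefficients of `x` can be
read off there. -/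
lemma shuffle_injective (p : ℕ) : Function.Injective (shuffle 𝕜 (N := N) (p + 1)) := by
  refine (injective_iff_map_eq_zero _).2 fun x hx => ?_
  ext g
  have h := DFunLike.congr_fun hx (insWord 0 g)
  rw [shuffle_apply, finsetSum_apply, Finset.sum_eq_single 0] at h
  · simpa [insMap, mapDomain_apply (insWord_injective 0)] using h
  · intro j _ hj
    rw [Finsupp.smul_apply, insMap_apply_of_ne (by simp; omega), smul_zero]
  · simp

lemma joinMap_mem {p : ℕ} {x : (Fin N → ℕ) →₀ 𝕜} (hx : x ∈ chains 𝕜 (inZero G) p) :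
    joinMap 𝕜 x ∈ chains 𝕜 G p := by
  suffices h : chains 𝕜 (inZero G) p ≤ (chains 𝕜 G p).comap (joinMap 𝕜) from h hx
  refine chains_le fun g hg => ?_
  rw [Submodule.mem_comap, joinMap_single]
  exact single_mem_chains ⟨isCell_consWord_zero.2 hg.1, hg.2⟩

lemma insMap_mem (hG : Hereditary G) {q j : ℕ} (hj : j ≤ q) {x : (Fin N → ℕ) →₀ 𝕜}
    (hx : x ∈ chains 𝕜 (offZero G) q) : insMap 𝕜 j x ∈ chains 𝕜 G (q + 1) := by
  suffices h : chains 𝕜 (offZero G) q ≤ (chains 𝕜 G (q + 1)).comap (insMap 𝕜 j) from h hx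
  refine chains_le fun g hg => ?_
  rw [Submodule.mem_comap, insMap_single]
  exact single_mem_chains ⟨hg.1.insWord hj, (hG.insWord_iff j g).2 hg.2⟩

lemma shuffle_mem (hG : Hereditary G) {q : ℕ} {x : (Fin N → ℕ) →₀ 𝕜}
    (hx : x ∈ chains 𝕜 (offZero G) q) : shuffle 𝕜 (q + 1) x ∈ chains 𝕜 G (q + 1) := by
  rw [shuffle_apply]
  exact Submodule.sum_mem _ fun j hj => Submodule.smul_mem _ _
    (insMap_mem hG (by have := Finset.mem_range.1 hj; omega) hx)

/-- The shuffle with a vertex anticommutes with the boundary. -/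
lemma bd_shuffle (hG : Hereditary G) (q : ℕ) {x : (Fin N → ℕ) →₀ 𝕜}
    (hx : x ∈ chains 𝕜 (offZero G) q) :
    bd 𝕜 G (q + 1) (shuffle 𝕜 (q + 1) x) = -shuffle 𝕜 q (bd 𝕜 (offZero G) q x) := by
  let F := fun i => faceMap 𝕜 (offZero G) q i x
  let A : ℕ → (Fin (N + 1) → ℕ) →₀ 𝕜 := fun j =>
    ∑ i ∈ Finset.range j, ((-1 : 𝕜) ^ j * (-1 : 𝕜) ^ i) • insMap 𝕜 (j - 1) (F i)
  -- The absorption terms `U` telescope, and wrapping `q + 1` to `0` closes the circle, so that they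
  -- cancel completely.
  let U : ℕ → (Fin (N + 1) → ℕ) →₀ 𝕜 := fun j => consMap 𝕜 G (if j = q + 1 then 0 else j) x
  let B : ℕ → (Fin (N + 1) → ℕ) →₀ 𝕜 := fun j =>
    ∑ i ∈ Finset.range (q - j), ((-1 : 𝕜) ^ j * (-1 : 𝕜) ^ (j + 1 + i)) •
      insMap 𝕜 j (F (j + 1 + i))
  have hsq : ∀ j : ℕ, (-1 : 𝕜) ^ j * (-1 : 𝕜) ^ j = 1 := fun j => by
    rw [← pow_add]; exact Even.neg_one_pow ⟨j, rfl⟩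
  have h1 : ∀ j ∈ Finset.range (q + 1), (-1 : 𝕜) ^ j • bd 𝕜 G (q + 1) (insMap 𝕜 j x) =
      A j + (U j - U (j + 1)) - B j := by
    intro j hj
    obtain ⟨l, rfl⟩ : ∃ l, q = j + l := ⟨q - j, by have := Finset.mem_range.1 hj; omega⟩
    have e1 : (if j = j + l + 1 then 0 else j) = j := if_neg (by omega)
    have e2 : (if j + 1 = j + l + 1 then 0 else j + 1) = (if l = 0 then 0 else j + 1) := by
      congr 1; simp
    have e3 : (-1 : 𝕜) ^ j * (-1 : 𝕜) ^ (j + 1) = -1 := by rw [pow_succ, ← mul_assoc, hsq, one_mul]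
    rw [bd_insMap hG j l hx]
    simp only [A, U, B, F, smul_sub, smul_add, Finset.smul_sum, smul_smul, e1, e2, hsq, e3,
      neg_smul, one_smul, Nat.add_sub_cancel_left]
    abel
  -- The faces before an insertion at index `j + 1` and those after an insertion at index `j`
  -- together give every face of `x`, each with the vertex inserted at index `j`.
  have h2 : ∀ j ∈ Finset.range q, A (j + 1) - B j =
      -((-1 : 𝕜) ^ j • insMap 𝕜 j (bd 𝕜 (offZero G) q x)) := by
    intro j hj
    have hj := Finset.mem_range.1 hj
    rw [bd_apply, show q + 1 = j + 1 + (q - j) by omega, Finset.sum_range_add, map_add, map_sum,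
      map_sum, smul_add, Finset.smul_sum, Finset.smul_sum, neg_add, sub_eq_add_neg]
    congr 1
    · rw [← Finset.sum_neg_distrib]
      refine Finset.sum_congr rfl fun i _ => ?_
      simp only [F, map_smul, smul_smul, ← neg_smul, Nat.add_sub_cancel]
      congr 1
      ring
    · simp only [B, F, map_smul, smul_smul]
  have hA : A 0 = 0 := by simp [A]
  have hB : B q = 0 := by simp [B]
  have hU : U 0 = U (q + 1) := by simp [U]
  rw [shuffle_apply, map_sum]
  simp only [map_smul]
  rw [Finset.sum_congr rfl h1, Finset.sum_sub_distrib, Finset.sum_add_distrib,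
    Finset.sum_range_sub', hU, sub_self, add_zero, Finset.sum_range_succ', hA, add_zero,
    Finset.sum_range_succ, hB, add_zero, ← Finset.sum_sub_distrib, Finset.sum_congr rfl h2,
    Finset.sum_neg_distrib, shuffle_apply]

variable (𝕜 G) in
/-- The chains in which the new vertex lies in the block in position `0` or is a block of its
own. -/
def reducedChains (p : ℕ) : Submodule 𝕜 ((Fin (N + 1) → ℕ) →₀ 𝕜) :=
  supported 𝕜 𝕜 {h | h ∈ cells G p ∧ (h 0 ≠ 0 → ∀ v : Fin N, h v.succ ≠ h 0)}

lemma insMap_mem_reducedChains (hG : Hereditary G) {q j : ℕ} (hj : j ≤ q)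
    {x : (Fin N → ℕ) →₀ 𝕜} (hx : x ∈ chains 𝕜 (offZero G) q) :
    insMap 𝕜 j x ∈ reducedChains 𝕜 G (q + 1) := by
  suffices h : chains 𝕜 (offZero G) q ≤ (reducedChains 𝕜 G (q + 1)).comap (insMap 𝕜 j) from h hx
  refine chains_le fun g hg => ?_
  rw [Submodule.mem_comap, insMap_single]
  exact single_mem_supported 𝕜 1
    ⟨⟨hg.1.insWord hj, (hG.insWord_iff j g).2 hg.2⟩, fun _ v => gap_ne _ _⟩

lemma faceMap_mem {p i : ℕ} {α : Type*} {G : (α → ℕ) → Prop} {x : (α → ℕ) →₀ 𝕜}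
    (hx : x ∈ chains 𝕜 G (p + 1)) : faceMap 𝕜 G (p + 1) i x ∈ chains 𝕜 G p := by
  suffices h : chains 𝕜 G (p + 1) ≤ (chains 𝕜 G p).comap (faceMap 𝕜 G (p + 1) i) from h hx
  refine chains_le fun f hf => ?_
  rw [Submodule.mem_comap, faceMap_single]
  exact term_mem_chains hf.1.face

/-- The boundary of a singleton inserted between two consecutive blocks trades absorption into one
for absorption into the other, modulo reduced chains. The vertex can thus be moved back block by
block to position `0`, where the word is reduced. -/
lemma consMap_mem (hG : Hereditary G) (p j : ℕ) (hj : j ≤ p) {x : (Fin N → ℕ) →₀ 𝕜}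
    (hx : x ∈ chains 𝕜 (offZero G) p) :
    consMap 𝕜 G j x ∈ reducedChains 𝕜 G p ⊔ boundaries 𝕜 G p := by
  induction j with
  | zero =>
    suffices h : chains 𝕜 (offZero G) p ≤ (reducedChains 𝕜 G p).comap (consMap 𝕜 G 0) from
      Submodule.mem_sup_left (h hx)
    refine chains_le fun g hg => ?_
    rw [Submodule.mem_comap, consMap_single]
    by_cases h : G (consWord 0 g)
    · rw [term_of 𝕜 h]
      exact single_mem_supported 𝕜 1 ⟨⟨isCell_consWord_zero.2 hg.1, h⟩, fun h => absurd rfl h⟩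
    · rw [term_of_not 𝕜 h]
      exact zero_mem _
  | succ j ih =>
    have ih := ih (by omega)
    -- Writing `l + 1` ensures that the right neighbour is block `j + 1` and not the wrapped block
    -- `0`.
    obtain ⟨l, rfl⟩ : ∃ l, p = j + (l + 1) := ⟨p - j - 1, by omega⟩
    have hb := bd_insMap hG j (l + 1) hx
    rw [if_neg (by omega)] at hb
    have hc : (-1 : 𝕜) ^ (j + 1) • consMap 𝕜 G (j + 1) x ∈
        reducedChains 𝕜 G (j + (l + 1)) ⊔ boundaries 𝕜 G (j + (l + 1)) := by
      have rearrange : ∀ {b s a c t : (Fin (N + 1) → ℕ) →₀ 𝕜},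
          b = s + a + c - t → c = t + b - (s + a) := by
        rintro b s a c t rfl
        abel
      rw [rearrange hb]
      refine Submodule.sub_mem _ (Submodule.add_mem _ (Submodule.mem_sup_left ?_)
        (Submodule.mem_sup_right ⟨_, insMap_mem hG (by omega) hx, rfl⟩))
        (Submodule.add_mem _ (Submodule.mem_sup_left ?_) (Submodule.smul_mem _ _ ih))
      · exact Submodule.sum_mem _ fun i _ => Submodule.smul_mem _ _
          (insMap_mem_reducedChains hG (q := j + l) (by omega) (faceMap_mem hx))
      · exact Submodule.sum_mem _ fun i _ => Submodule.smul_mem _ _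
          (insMap_mem_reducedChains hG (q := j + l) (by omega) (faceMap_mem hx))
    exact (Submodule.smul_mem_iff _ (pow_ne_zero _ (neg_ne_zero.2 one_ne_zero))).1 hc

lemma eq_consWord (h : Fin (N + 1) → ℕ) : h = consWord (h 0) (fun v => h v.succ) :=
  (Fin.cons_self_tail h).symm

/-- The companion `v` keeps the block occupied after the vertex `0` is deleted, so the degree does
not drop. -/
lemma IsCell.tail {p : ℕ} {h : Fin (N + 1) → ℕ} (hc : IsCell p h) {v : Fin N}
    (hv : h v.succ = h 0) : IsCell p fun v : Fin N => h v.succ := by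
  refine ⟨fun v => hc.1 _, fun j h1 h2 => ?_⟩
  obtain ⟨w, hw⟩ := hc.2 j h1 h2
  revert hw
  exact Fin.cases (fun hw => ⟨v, hv.trans hw⟩) (fun w hw => ⟨w, hw⟩) w

lemma chains_le_sup (hG : Hereditary G) (p : ℕ) :
    chains 𝕜 G p ≤ reducedChains 𝕜 G p ⊔ boundaries 𝕜 G p := by
  refine chains_le fun h hh => ?_
  by_cases hr : h 0 ≠ 0 → ∀ v : Fin N, h v.succ ≠ h 0
  · exact Submodule.mem_sup_left (single_mem_supported 𝕜 1 ⟨hh, hr⟩)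
  · push Not at hr
    obtain ⟨h0, v, hv⟩ := hr
    have hG' : offZero G fun v => h v.succ := by
      rw [← hG.consWord_iff h0, ← eq_consWord]
      exact hh.2
    have := consMap_mem (𝕜 := 𝕜) hG p (h 0) (hh.1.1 0)
      (single_mem_chains (𝕜 := 𝕜) ⟨hh.1.tail hv, hG'⟩)
    rwa [consMap_single, ← eq_consWord, term_of 𝕜 hh.2] at this

lemma exists_of_mem_reducedChains (hG : Hereditary G) {q : ℕ} {x : (Fin (N + 1) → ℕ) →₀ 𝕜}
    (hx : x ∈ reducedChains 𝕜 G (q + 1)) :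
    ∃ a ∈ chains 𝕜 (inZero G) (q + 1), ∃ b : ℕ → (Fin N → ℕ) →₀ 𝕜,
      (∀ j, b j ∈ chains 𝕜 (offZero G) q) ∧
        x = joinMap 𝕜 a + ∑ j ∈ Finset.range (q + 1), insMap 𝕜 j (b j) := by
  rw [reducedChains, supported_eq_span_single] at hx
  induction hx using Submodule.span_induction with
  | mem x hx =>
    obtain ⟨h, ⟨hc, hr⟩, rfl⟩ := hx
    by_cases h0 : h 0 = 0
    · refine ⟨single (fun v => h v.succ) 1, single_mem_chains ⟨?_, ?_⟩, 0, fun j => zero_mem _, ?_⟩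
      · rw [← isCell_consWord_zero, ← h0, ← eq_consWord]
        exact hc.1
      · rw [inZero, ← h0, ← eq_consWord]
        exact hc.2
      · rw [joinMap_single, ← h0, ← eq_consWord]
        simp
    · obtain ⟨j, hj⟩ := Nat.exists_eq_succ_of_ne_zero h0
      have he := eq_consWord h
      rw [hj] at he
      obtain ⟨q', g, hq, hjq, hg, hw⟩ := exists_insWord (he ▸ hc.1)
        fun v => by rw [← Nat.succ_eq_add_one, ← hj]; exact hr h0 v
      obtain rfl : q = q' := by omega
      rw [he, Nat.succ_eq_add_one, hw] at hc ⊢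
      refine ⟨0, zero_mem _, Pi.single j (single g 1), fun i => ?_, ?_⟩
      · by_cases hij : i = j
        · subst hij
          rw [Pi.single_eq_same]
          exact single_mem_chains ⟨hg, (hG.insWord_iff _ _).1 hc.2⟩
        · rw [Pi.single_eq_of_ne hij]
          exact zero_mem _
      · rw [Finset.sum_eq_single j]
        · simp
        · intro i _ hij
          rw [Pi.single_eq_of_ne hij, map_zero]
        · intro h
          exact absurd (Finset.mem_range.2 (by omega)) h
  | zero => exact ⟨0, zero_mem _, 0, fun j => zero_mem _, by simp⟩
  | add x y _ _ hx hy =>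
    obtain ⟨a, ha, b, hb, rfl⟩ := hx
    obtain ⟨a', ha', b', hb', rfl⟩ := hy
    refine ⟨a + a', add_mem ha ha', b + b', fun j => add_mem (hb j) (hb' j), ?_⟩
    simp only [map_add, Pi.add_apply, Finset.sum_add_distrib]
    abel
  | smul c x _ hx =>
    obtain ⟨a, ha, b, hb, rfl⟩ := hx
    refine ⟨c • a, Submodule.smul_mem _ _ ha, c • b, fun j => Submodule.smul_mem _ _ (hb j), ?_⟩
    simp only [map_smul, Pi.smul_apply, smul_add, Finset.smul_sum]

lemma consMap_apply (hG : Hereditary G) {q i j : ℕ} {x : (Fin N → ℕ) →₀ 𝕜}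
    (hx : x ∈ chains 𝕜 (offZero G) q) (g : Fin N → ℕ) :
    consMap 𝕜 G i x (consWord (j + 1) g) = if i = j + 1 then x g else 0 := by
  classical
  have := eqOn_chains (φ := lapply (consWord (j + 1) g) ∘ₗ consMap 𝕜 G i)
    (ψ := if i = j + 1 then lapply g else 0) (fun f hf => ?_) hx
  · rw [LinearMap.comp_apply, lapply_apply] at this
    rw [this]
    split_ifs <;> rfl
  · rw [LinearMap.comp_apply, lapply_apply, consMap_single]
    split_ifs with hi
    · subst hi
      rw [term_of 𝕜 ((hG.consWord_iff (by omega) f).2 hf.2), lapply_apply, single_apply,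
        single_apply]
      by_cases hfg : f = g
      · simp [hfg]
      · rw [if_neg hfg, if_neg fun he => hfg (consWord_inj he).2]
    · by_cases h : G (consWord i f)
      · rw [term_of 𝕜 h, LinearMap.zero_apply, single_apply, if_neg]
        exact fun he => hi (consWord_inj he).1
      · rw [term_of_not 𝕜 h]
        rfl

/-- In the tested word the new vertex shares its block with `v`, so only absorption terms
contribute: from a singleton just after that block (`i = j + 1`) or just before it (`i = j`), with
equal signs. -/
lemma bd_insMap_apply (hG : Hereditary G) {q i j : ℕ} (hi : i ≤ q) (hj : j < q)
    {x : (Fin N → ℕ) →₀ 𝕜} (hx : x ∈ chains 𝕜 (offZero G) q) {g : Fin N → ℕ} {v : Fin N}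
    (hv : g v = j + 1) :
    bd 𝕜 G (q + 1) (insMap 𝕜 i x) (consWord (j + 1) g) =
      (if i = j + 1 then (-1 : 𝕜) ^ (j + 1) * x g else 0) +
        (if i = j then (-1 : 𝕜) ^ (j + 1) * x g else 0) := by
  obtain ⟨l, rfl⟩ : ∃ l, q = i + l := ⟨q - i, by omega⟩
  have hv' : consWord (j + 1) g v.succ = consWord (j + 1) g 0 := hv
  rw [bd_insMap hG i l hx]
  simp only [Finsupp.sub_apply, Finsupp.add_apply, Finsupp.smul_apply, finsetSum_apply,
    insMap_apply_of_eq hv', mul_zero, Finset.sum_const_zero, zero_add, sub_zero,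
    consMap_apply hG hx, smul_eq_mul]
  congr 1
  · by_cases h : i = j + 1 <;> simp [h]
  · by_cases h : i = j
    · subst h
      simp [show l ≠ 0 by omega]
    · by_cases hl : l = 0 <;> simp [h, hl]

lemma exists_eq_joinMap_add_shuffle (hG : Hereditary G) {q : ℕ} {x : (Fin (N + 1) → ℕ) →₀ 𝕜}
    (hx : x ∈ reducedChains 𝕜 G (q + 1)) (hbd : bd 𝕜 G (q + 1) x ∈ reducedChains 𝕜 G q) :
    ∃ a ∈ chains 𝕜 (inZero G) (q + 1), ∃ b ∈ chains 𝕜 (offZero G) q,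
      x = joinMap 𝕜 a + shuffle 𝕜 (q + 1) b := by
  obtain ⟨a, ha, b, hb, rfl⟩ := exists_of_mem_reducedChains hG hx
  refine ⟨a, ha, b 0, hb 0, ?_⟩
  -- The boundary has no coefficient at unreduced words; there the two contributions must cancel,
  -- which forces the alternating signs of a shuffle.
  have key : ∀ j < q, b (j + 1) = -b j := by
    intro j hj
    ext g
    by_cases hg : g ∈ cells (offZero G) q
    · obtain ⟨v, hv⟩ := hg.1.2 (j + 1) (by omega) hj
      have h0 := (mem_supported' 𝕜 _).1 hbd (consWord (j + 1) g)
        fun h => h.2 (by simp) v hv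
      rw [map_add, map_sum, Finsupp.add_apply, finsetSum_apply, bd_joinMap,
        joinMap_apply_of_ne (by simp), zero_add, Finset.sum_congr rfl fun i hi =>
          bd_insMap_apply hG (Nat.lt_succ_iff.1 (Finset.mem_range.1 hi)) hj (hb i) hv,
        Finset.sum_add_distrib, Finset.sum_ite_eq', Finset.sum_ite_eq',
        if_pos (Finset.mem_range.2 (by omega)), if_pos (Finset.mem_range.2 (by omega)),
        ← mul_add] at h0
      exact eq_neg_of_add_eq_zero_left ((mul_eq_zero.1 h0).resolve_left
        (pow_ne_zero _ (neg_ne_zero.2 one_ne_zero)))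
    · rw [Finsupp.neg_apply, (mem_supported' 𝕜 _).1 (hb _) g hg,
        (mem_supported' 𝕜 _).1 (hb _) g hg, neg_zero]
  have key' : ∀ j ≤ q, b j = (-1 : 𝕜) ^ j • b 0 := by
    intro j
    induction j with
    | zero => simp
    | succ j ih =>
      intro hj
      rw [key j (by omega), ih (by omega), pow_succ, mul_neg_one, neg_smul]
  rw [shuffle_apply]
  congr 1
  refine Finset.sum_congr rfl fun j hj => ?_
  rw [key' j (Nat.lt_succ_iff.1 (Finset.mem_range.1 hj)), map_smul]

lemma joinMap_mem_reducedChains {p : ℕ} {x : (Fin N → ℕ) →₀ 𝕜}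
    (hx : x ∈ chains 𝕜 (inZero G) p) : joinMap 𝕜 x ∈ reducedChains 𝕜 G p := by
  suffices h : chains 𝕜 (inZero G) p ≤ (reducedChains 𝕜 G p).comap (joinMap 𝕜) from h hx
  refine chains_le fun g hg => ?_
  rw [Submodule.mem_comap, joinMap_single]
  exact single_mem_supported 𝕜 1
    ⟨⟨isCell_consWord_zero.2 hg.1, hg.2⟩, fun h => absurd rfl h⟩

lemma shuffle_mem_reducedChains (hG : Hereditary G) {q : ℕ} {x : (Fin N → ℕ) →₀ 𝕜}
    (hx : x ∈ chains 𝕜 (offZero G) q) :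
    shuffle 𝕜 (q + 1) x ∈ reducedChains 𝕜 G (q + 1) := by
  rw [shuffle_apply]
  exact Submodule.sum_mem _ fun j hj => Submodule.smul_mem _ _
    (insMap_mem_reducedChains hG (by have := Finset.mem_range.1 hj; omega) hx)

/-- Joins have the new vertex in position `0` and shuffles never do. One cannot conclude `y = 0`,
since the shuffle is zero for `p = 0`. -/
lemma eq_zero_of_joinMap_add_shuffle {p : ℕ} {a y : (Fin N → ℕ) →₀ 𝕜}
    (h : joinMap 𝕜 a + shuffle 𝕜 p y = 0) : a = 0 ∧ shuffle 𝕜 p y = 0 := by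
  have ha : a = 0 := by
    ext g
    have := DFunLike.congr_fun h (consWord 0 g)
    rw [Finsupp.add_apply, shuffle_apply_of_eq (by simp), add_zero, joinMap, lmapDomain_apply,
      mapDomain_apply (consWord_injective 0)] at this
    exact this
  rw [ha, map_zero, zero_add] at h
  exact ⟨ha, h⟩

lemma finrank_map_joinMap_sup (q : ℕ) (X Y : Submodule 𝕜 ((Fin N → ℕ) →₀ 𝕜))
    [FiniteDimensional 𝕜 X] [FiniteDimensional 𝕜 Y] :
    Module.finrank 𝕜 ↥(X.map (joinMap 𝕜) ⊔ Y.map (shuffle 𝕜 (q + 1))) =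
      Module.finrank 𝕜 X + Module.finrank 𝕜 Y := by
  have hd : X.map (joinMap 𝕜) ⊓ Y.map (shuffle 𝕜 (q + 1)) = ⊥ := by
    rw [eq_bot_iff]
    rintro _ ⟨⟨a, -, rfl⟩, ⟨y, -, hy⟩⟩
    have h : joinMap 𝕜 a + shuffle 𝕜 (q + 1) (-y) = 0 := by rw [map_neg, hy, add_neg_cancel]
    rw [(eq_zero_of_joinMap_add_shuffle h).1, map_zero]
    exact zero_mem _
  have h := Submodule.finrank_sup_add_finrank_inf_eq (X.map (joinMap 𝕜))
    (Y.map (shuffle 𝕜 (q + 1)))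
  rw [hd, finrank_bot, add_zero] at h
  rw [h, ← (Submodule.equivMapOfInjective _ joinMap_injective X).finrank_eq,
    ← (Submodule.equivMapOfInjective _ (shuffle_injective q) Y).finrank_eq]

lemma joinMap_mem_cycles {q : ℕ} {a : (Fin N → ℕ) →₀ 𝕜} (ha : a ∈ cycles 𝕜 (inZero G) (q + 1)) :
    joinMap 𝕜 a ∈ cycles 𝕜 G (q + 1) :=
  ⟨joinMap_mem ha.1, LinearMap.mem_ker.2 (by rw [bd_joinMap, LinearMap.mem_ker.1 ha.2, map_zero])⟩

/-- Degree `0` is separate: there `bd` need not vanish on a cycle, but the shuffle is an empty sum.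
-/
lemma shuffle_bd_of_mem_cycles {q : ℕ} {b : (Fin N → ℕ) →₀ 𝕜}
    (hb : b ∈ cycles 𝕜 (offZero G) q) : shuffle 𝕜 q (bd 𝕜 (offZero G) q b) = 0 := by
  cases q with
  | zero => simp [shuffle]
  | succ q => rw [LinearMap.mem_ker.1 hb.2, map_zero]

lemma shuffle_mem_cycles (hG : Hereditary G) {q : ℕ} {b : (Fin N → ℕ) →₀ 𝕜}
    (hb : b ∈ cycles 𝕜 (offZero G) q) : shuffle 𝕜 (q + 1) b ∈ cycles 𝕜 G (q + 1) :=
  ⟨shuffle_mem hG (cycles_le_chains q hb), LinearMap.mem_ker.2 (by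
    rw [bd_shuffle hG q (cycles_le_chains q hb), shuffle_bd_of_mem_cycles hb, neg_zero])⟩

/-- Subtracting a boundary makes a cycle reduced. Its boundary is zero, hence reduced, so it is a
join plus a shuffle, and independence of the two parts makes each come from a cycle. -/
lemma cycles_eq_sup (hG : Hereditary G) (q : ℕ) :
    cycles 𝕜 G (q + 1) =
      ((cycles 𝕜 (inZero G) (q + 1)).map (joinMap 𝕜) ⊔
        (cycles 𝕜 (offZero G) q).map (shuffle 𝕜 (q + 1))) ⊔ boundaries 𝕜 G (q + 1) := by
  refine le_antisymm (fun x hx => ?_) (sup_le (sup_le ?_ ?_)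
    (boundaries_le_cycles hG.faceStable (q + 1)))
  · obtain ⟨u, hu, w, hw, rfl⟩ := Submodule.mem_sup.1 (chains_le_sup hG _ hx.1)
    have hw0 := LinearMap.mem_ker.1 (boundaries_le_cycles hG.faceStable (q + 1) hw).2
    have hu0 : bd 𝕜 G (q + 1) u = 0 := by
      have := LinearMap.mem_ker.1 hx.2
      rwa [map_add, hw0, add_zero] at this
    obtain ⟨a, ha, b, hb, rfl⟩ :=
      exists_eq_joinMap_add_shuffle hG hu (by rw [hu0]; exact zero_mem _)
    rw [map_add, bd_joinMap, bd_shuffle hG q hb, ← map_neg] at hu0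
    obtain ⟨ha0, hb0⟩ := eq_zero_of_joinMap_add_shuffle hu0
    refine Submodule.add_mem_sup (Submodule.add_mem_sup ⟨a, ⟨ha, ha0⟩, rfl⟩ ⟨b, ?_, rfl⟩) hw
    cases q with
    | zero => exact hb
    | succ q =>
      refine ⟨hb, LinearMap.mem_ker.2 ?_⟩
      rw [← neg_eq_zero]
      exact shuffle_injective q (hb0.trans (map_zero _).symm)
  · rintro _ ⟨a, ha, rfl⟩
    exact joinMap_mem_cycles ha
  · rintro _ ⟨b, hb, rfl⟩
    exact shuffle_mem_cycles hG hb

/-- The same argument is applied to a bounding chain: made reduced, it has a boundary in the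
left-hand sum, which consists of reduced chains, so it splits itself. -/
lemma inf_boundaries_eq_sup (hG : Hereditary G) (q : ℕ) :
    ((cycles 𝕜 (inZero G) (q + 1)).map (joinMap 𝕜) ⊔
        (cycles 𝕜 (offZero G) q).map (shuffle 𝕜 (q + 1))) ⊓ boundaries 𝕜 G (q + 1) =
      (boundaries 𝕜 (inZero G) (q + 1)).map (joinMap 𝕜) ⊔
        (boundaries 𝕜 (offZero G) q).map (shuffle 𝕜 (q + 1)) := by
  refine le_antisymm ?_ (le_inf (sup_le_sup
    (Submodule.map_mono (boundaries_le_cycles hG.inZero.faceStable _))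
    (Submodule.map_mono (boundaries_le_cycles hG.offZero.faceStable _))) (sup_le ?_ ?_))
  · rintro x ⟨hx, u, hu, rfl⟩
    obtain ⟨u, hu', w, hw, rfl⟩ := Submodule.mem_sup.1 (chains_le_sup hG _ hu)
    have hw0 := LinearMap.mem_ker.1 (boundaries_le_cycles hG.faceStable (q + 2) hw).2
    rw [map_add, hw0, add_zero] at hx ⊢
    have hr : bd 𝕜 G (q + 1 + 1) u ∈ reducedChains 𝕜 G (q + 1) := by
      refine (sup_le ?_ ?_ : _ ≤ reducedChains 𝕜 G (q + 1)) hx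
      · rintro _ ⟨a, ha, rfl⟩
        exact joinMap_mem_reducedChains ha.1
      · rintro _ ⟨b, hb, rfl⟩
        exact shuffle_mem_reducedChains hG (cycles_le_chains q hb)
    obtain ⟨a, ha, b, hb, rfl⟩ := exists_eq_joinMap_add_shuffle hG hu' hr
    rw [map_add, bd_joinMap, bd_shuffle hG _ hb]
    exact Submodule.add_mem_sup ⟨_, ⟨a, ha, rfl⟩, rfl⟩ (neg_mem ⟨_, ⟨b, hb, rfl⟩, rfl⟩)
  · rintro _ ⟨_, ⟨a, ha, rfl⟩, rfl⟩
    exact ⟨joinMap 𝕜 a, joinMap_mem ha, bd_joinMap _ a⟩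
  · rintro _ ⟨_, ⟨b, hb, rfl⟩, rfl⟩
    refine ⟨-shuffle 𝕜 (q + 2) b, neg_mem (shuffle_mem hG hb), ?_⟩
    rw [map_neg, bd_shuffle hG _ hb, neg_neg]

/-- The excess of cycles over boundaries splits according to whether a vertex lies in the block in
position `0`. -/
lemma finrank_cycles_succ (hG : Hereditary G) (q : ℕ) :
    Module.finrank 𝕜 (cycles 𝕜 G (q + 1)) + (Module.finrank 𝕜 (boundaries 𝕜 (inZero G) (q + 1)) +
        Module.finrank 𝕜 (boundaries 𝕜 (offZero G) q)) =
      Module.finrank 𝕜 (cycles 𝕜 (inZero G) (q + 1)) +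
        Module.finrank 𝕜 (cycles 𝕜 (offZero G) q) + Module.finrank 𝕜 (boundaries 𝕜 G (q + 1)) := by
  rw [← finrank_map_joinMap_sup q (cycles 𝕜 (inZero G) (q + 1)),
    ← finrank_map_joinMap_sup q (boundaries 𝕜 (inZero G) (q + 1)), ← inf_boundaries_eq_sup hG,
    cycles_eq_sup hG, Submodule.finrank_sup_add_finrank_inf_eq]

end Decomposition

/-! ### Counting homology classes by critical sets. -/

section Dimension

open Classical in
/-- The word with the vertices outside `A` in position `0`. -/
def indicatorWord {α : Type*} (A : Finset α) (v : α) : ℕ := if v ∈ A then 1 else 0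

open Classical in
/-- The sets of `p` vertices whose complement is an admissible block in position `0`. -/
def criticalSets {α : Type*} [Fintype α] (G : (α → ℕ) → Prop) (p : ℕ) : Finset (Finset α) :=
  {A | A.card = p ∧ G (indicatorWord A)}

lemma mem_criticalSets {α : Type*} [Fintype α] {G : (α → ℕ) → Prop} {p : ℕ} {A : Finset α} :
    A ∈ criticalSets G p ↔ A.card = p ∧ G (indicatorWord A) := by
  simp [criticalSets]

variable {N : ℕ} {G : (Fin (N + 1) → ℕ) → Prop}

lemma indicatorWord_map_succ (A : Finset (Fin N)) :
    indicatorWord (A.map (Fin.succEmb N)) = consWord 0 (indicatorWord A) := by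
  funext v
  refine Fin.cases ?_ (fun v => ?_) v <;> simp [indicatorWord]

lemma indicatorWord_insert_zero (A : Finset (Fin N)) :
    indicatorWord (insert 0 (A.map (Fin.succEmb N))) = consWord 1 (indicatorWord A) := by
  funext v
  refine Fin.cases ?_ (fun v => ?_) v <;> simp [indicatorWord]

lemma zero_notMem_map_succ (A : Finset (Fin N)) : (0 : Fin (N + 1)) ∉ A.map (Fin.succEmb N) := by
  simp

lemma exists_map_succ (A : Finset (Fin (N + 1))) :
    ∃ B : Finset (Fin N), A = B.map (Fin.succEmb N) ∨ A = insert 0 (B.map (Fin.succEmb N)) := by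
  refine ⟨Finset.univ.filter fun v => v.succ ∈ A, ?_⟩
  by_cases h : 0 ∈ A
  · right
    ext v
    refine Fin.cases ?_ (fun v => ?_) v <;> simp [h]
  · left
    ext v
    refine Fin.cases ?_ (fun v => ?_) v <;> simp [h]

/-- Splitting by whether `0 ∈ A` gives the same recursion as `finrank_cycles_succ`. -/
lemma card_criticalSets_succ (p : ℕ) :
    (criticalSets G (p + 1)).card =
      (criticalSets (inZero G) (p + 1)).card + (criticalSets (offZero G) p).card := by
  have h : criticalSets G (p + 1) =
      (criticalSets (inZero G) (p + 1)).image (fun A => A.map (Fin.succEmb N)) ∪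
        (criticalSets (offZero G) p).image (fun A => insert 0 (A.map (Fin.succEmb N))) := by
    ext A
    simp only [Finset.mem_union, Finset.mem_image, mem_criticalSets, inZero, offZero,
      ← indicatorWord_map_succ, ← indicatorWord_insert_zero]
    constructor
    · rintro ⟨hA, hA'⟩
      obtain ⟨B, rfl | rfl⟩ := exists_map_succ A
      · exact Or.inl ⟨B, ⟨by simpa using hA, hA'⟩, rfl⟩
      · rw [Finset.card_insert_of_notMem (zero_notMem_map_succ B), Finset.card_map] at hA
        exact Or.inr ⟨B, ⟨by omega, hA'⟩, rfl⟩
    · rintro (⟨B, ⟨hB, hB'⟩, rfl⟩ | ⟨B, ⟨hB, hB'⟩, rfl⟩)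
      · exact ⟨by simpa using hB, hB'⟩
      · rw [Finset.card_insert_of_notMem (zero_notMem_map_succ B), Finset.card_map, hB]
        exact ⟨rfl, hB'⟩
  rw [h, Finset.card_union_of_disjoint, Finset.card_image_of_injective,
    Finset.card_image_of_injective]
  · intro A B hAB
    refine Finset.map_injective (Fin.succEmb N) ?_
    rw [← Finset.erase_insert (zero_notMem_map_succ A), ← Finset.erase_insert
      (zero_notMem_map_succ B)]
    exact congrArg (fun s => s.erase 0) hAB
  · exact Finset.map_injective _
  · rw [Finset.disjoint_left]
    intro A hA hA'
    obtain ⟨B, -, rfl⟩ := Finset.mem_image.1 hA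
    obtain ⟨B', -, hB'⟩ := Finset.mem_image.1 hA'
    exact zero_notMem_map_succ B (hB' ▸ Finset.mem_insert_self _ _)

variable (𝕜 : Type*) [Field 𝕜]

/-- Both faces of a word with positions `0` and `1` are the zero word, with opposite signs. -/
lemma boundaries_zero {α : Type*} (G : (α → ℕ) → Prop) : boundaries 𝕜 G 0 = ⊥ := by
  rw [eq_bot_iff, boundaries, Submodule.map_le_iff_le_comap]
  refine chains_le fun f hf => ?_
  have : face 1 0 ∘ f = face 1 1 ∘ f := by
    funext v
    have := hf.1.1 v
    simp only [Function.comp, face]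
    split_ifs <;> omega
  rw [Submodule.mem_comap, bd_single, Submodule.mem_bot]
  simp [Finset.sum_range_succ, this]

lemma finrank_chains_zero {α : Type*} [Fintype α] (G : (α → ℕ) → Prop) :
    Module.finrank 𝕜 (chains 𝕜 G 0) = (criticalSets G 0).card := by
  have hcell : ∀ f ∈ cells G 0, f = 0 := fun f hf => funext fun v => Nat.le_zero.1 (hf.1.1 v)
  have hind : indicatorWord (∅ : Finset α) = 0 := by funext v; simp [indicatorWord]
  by_cases h : G 0
  · have h1 : cells G 0 = {0} := by
      refine Set.eq_singleton_iff_unique_mem.2 ⟨⟨⟨fun v => le_rfl, fun j h1 h2 => ?_⟩, h⟩, hcell⟩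
      omega
    have h2 : criticalSets G 0 = {∅} := by
      ext A
      rw [mem_criticalSets, Finset.card_eq_zero, Finset.mem_singleton]
      refine ⟨And.left, fun hA => ⟨hA, ?_⟩⟩
      rw [hA, hind]
      exact h
    rw [chains, h1, h2, (supportedEquivFinsupp (R := 𝕜) (M := 𝕜) _).finrank_eq]
    simp
  · have h1 : cells G 0 = ∅ :=
      Set.eq_empty_of_forall_notMem fun f hf => h (hcell f hf ▸ hf.2)
    have h2 : criticalSets G 0 = ∅ := by
      refine Finset.eq_empty_of_forall_notMem fun A hA => h ?_
      obtain ⟨hA, hA'⟩ := mem_criticalSets.1 hA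
      rwa [Finset.card_eq_zero.1 hA, hind] at hA'
    rw [chains, h1, h2, supported_empty, finrank_bot, Finset.card_empty]

/-- For a hereditary predicate, the homology of degree `p` has the critical sets with `p` elements
as a basis. -/
theorem finrank_cycles {N : ℕ} {G : (Fin N → ℕ) → Prop} (hG : Hereditary G) (p : ℕ) :
    Module.finrank 𝕜 (cycles 𝕜 G p) =
      Module.finrank 𝕜 (boundaries 𝕜 G p) + (criticalSets G p).card := by
  induction N generalizing p with
  | zero =>
    cases p with
    | zero => rw [boundaries_zero, finrank_bot, zero_add]; exact finrank_chains_zero 𝕜 G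
    | succ p =>
      have h0 : cycles 𝕜 G (p + 1) = ⊥ := by
        rw [eq_bot_iff]
        refine (cycles_le_chains _).trans (chains_le fun f hf => ?_)
        obtain ⟨v, -⟩ := hf.1.2 1 le_rfl (by omega)
        exact v.elim0
      have h1 : boundaries 𝕜 G (p + 1) = ⊥ := by
        rw [eq_bot_iff, ← h0]
        exact boundaries_le_cycles hG.faceStable _
      have h2 : criticalSets G (p + 1) = ∅ := by
        refine Finset.eq_empty_of_forall_notMem fun A hA => ?_
        have := (mem_criticalSets.1 hA).1
        rw [Finset.eq_empty_of_isEmpty A] at this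
        simp at this
      rw [h0, h1, h2, finrank_bot, Finset.card_empty]
  | succ N ih =>
    cases p with
    | zero => rw [boundaries_zero, finrank_bot, zero_add]; exact finrank_chains_zero 𝕜 G
    | succ p =>
      have := finrank_cycles_succ (𝕜 := 𝕜) hG p
      rw [ih hG.inZero, ih hG.offZero] at this
      rw [card_criticalSets_succ]
      omega

end Dimension

/-! ### Cyclic rotation and change of root. -/

/-- The effect on the positions `0, ..., p` of moving the first block to the end. -/
def rot (p x : ℕ) : ℕ := if x = 0 then p else x - 1

/-- The effect on the positions `0, ..., p` of moving the first `s` blocks to the end. -/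
def rotBy (p s x : ℕ) : ℕ := if x < s then x + (p + 1) - s else x - s

lemma rotBy_zero (p x : ℕ) : rotBy p 0 x = x := by simp [rotBy]

lemma rotBy_self (p s : ℕ) : rotBy p s s = 0 := by simp [rotBy]

lemma rotBy_le {p s x : ℕ} (hs : s ≤ p) (hx : x ≤ p) : rotBy p s x ≤ p := by
  unfold rotBy; split_ifs <;> omega

lemma rotBy_inj {p s x y : ℕ} (hs : s ≤ p) (hx : x ≤ p) (hy : y ≤ p) :
    rotBy p s x = rotBy p s y ↔ x = y := by
  constructor
  · unfold rotBy; split_ifs <;> intro h <;> omega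
  · rintro rfl; rfl

lemma rotBy_surj {p s : ℕ} (hs : s ≤ p) {y : ℕ} (hy : y ≤ p) : ∃ x ≤ p, rotBy p s x = y := by
  by_cases h : y + s ≤ p
  · exact ⟨y + s, h, by unfold rotBy; split_ifs <;> omega⟩
  · exact ⟨y + s - (p + 1), by omega, by unfold rotBy; split_ifs <;> omega⟩

lemma rot_rotBy {p s x : ℕ} (hs : s + 1 ≤ p) : rot p (rotBy p s x) = rotBy p (s + 1) x := by
  grind [rot, rotBy]

lemma rotBy_rot {p s x : ℕ} (hs : s + 1 ≤ p) :
    rotBy p s (rot p x) = rotBy p (s + 1) x := by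
  grind [rot, rotBy]

lemma rotBy_self_rot {p x : ℕ} (hx : x ≤ p) : rotBy p p (rot p x) = x := by
  grind [rot, rotBy]

lemma face_rot {p i x : ℕ} (hi : i < p + 1) (hx : x ≤ p + 1) :
    face (p + 1) i (rot (p + 1) x) = rot p (face (p + 1) (i + 1) x) := by
  unfold face rot; split_ifs <;> omega

lemma face_last_rot {p x : ℕ} (hx : x ≤ p + 1) :
    face (p + 1) (p + 1) (rot (p + 1) x) = face (p + 1) 0 x := by
  unfold face rot; split_ifs <;> omega

/-- A predicate that depends only on the partition into blocks, and becomes truer when the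
partition is refined. -/
def RefinementStable {α : Type*} (E : (α → ℕ) → Prop) : Prop :=
  ∀ f f' : α → ℕ, (∀ u v, f u = f v → f' u = f' v) → E f' → E f

/-- The predicate `E` for words with the vertex `c` in position `0`. -/
def rooted {α : Type*} (E : (α → ℕ) → Prop) (c : α) (f : α → ℕ) : Prop := f c = 0 ∧ E f

section Rotation

variable (𝕜 : Type*) [Field 𝕜] {α : Type*} {E : (α → ℕ) → Prop}

lemma RefinementStable.comp_iff (hE : RefinementStable E) {φ : ℕ → ℕ} {p : ℕ} {f : α → ℕ}
    (hf : ∀ v, f v ≤ p) (hφ : ∀ x y, x ≤ p → y ≤ p → φ x = φ y → x = y) :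
    E (φ ∘ f) ↔ E f :=
  ⟨hE _ _ fun _ _ h => congrArg φ h, hE _ _ fun u v h => hφ _ _ (hf u) (hf v) h⟩

lemma RefinementStable.rot_iff (hE : RefinementStable E) {p : ℕ} {f : α → ℕ}
    (hf : ∀ v, f v ≤ p) : E (rot p ∘ f) ↔ E f :=
  hE.comp_iff hf fun x y hx hy => by unfold rot; split_ifs <;> intro h <;> omega

lemma RefinementStable.rotBy_iff (hE : RefinementStable E) {p s : ℕ} {f : α → ℕ} (hs : s ≤ p)
    (hf : ∀ v, f v ≤ p) : E (rotBy p s ∘ f) ↔ E f :=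
  hE.comp_iff hf fun _ _ hx hy => (rotBy_inj hs hx hy).1

/-- The cyclic rotation of words, with its sign. -/
def rotMap (p : ℕ) : ((α → ℕ) →₀ 𝕜) →ₗ[𝕜] ((α → ℕ) →₀ 𝕜) :=
  linearCombination 𝕜 fun f => (-1 : 𝕜) ^ p • single (rot p ∘ f) 1

/-- The signed rotation of words which brings the vertex `c` to position `0`. -/
def rootMap (c : α) (p : ℕ) : ((α → ℕ) →₀ 𝕜) →ₗ[𝕜] ((α → ℕ) →₀ 𝕜) :=
  linearCombination 𝕜 fun f => (-1 : 𝕜) ^ (p * f c) • single (rotBy p (f c) ∘ f) 1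

@[simp] lemma rotMap_single (p : ℕ) (f : α → ℕ) :
    rotMap 𝕜 p (single f 1) = (-1 : 𝕜) ^ p • single (rot p ∘ f) 1 := by
  simp [rotMap]

@[simp] lemma rootMap_single (c : α) (p : ℕ) (f : α → ℕ) :
    rootMap 𝕜 c p (single f 1) = (-1 : 𝕜) ^ (p * f c) • single (rotBy p (f c) ∘ f) 1 := by
  simp [rootMap]

lemma rotMap_term (hE : RefinementStable E) {p : ℕ} {f : α → ℕ} (hf : ∀ v, f v ≤ p) :
    rotMap 𝕜 p (term 𝕜 E f) = (-1 : 𝕜) ^ p • term 𝕜 E (rot p ∘ f) := by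
  by_cases h : E f
  · rw [term_of 𝕜 h, term_of 𝕜 ((hE.rot_iff hf).2 h), rotMap_single]
  · rw [term_of_not 𝕜 h, term_of_not 𝕜 (fun h' => h ((hE.rot_iff hf).1 h')), map_zero, smul_zero]

variable {𝕜}

/-- `rootMap` picks the representative of a rotation class with `c` in front, so a previous signed
rotation is invisible to it. -/
lemma rootMap_single_rot (c : α) {p : ℕ} {f : α → ℕ} (hf : ∀ v, f v ≤ p) :
    rootMap 𝕜 c p (rotMap 𝕜 p (single f 1)) = rootMap 𝕜 c p (single f 1) := by
  rw [rotMap_single, map_smul, rootMap_single, rootMap_single, smul_smul, ← pow_add]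
  by_cases h : f c = 0
  · have h1 : (rot p ∘ f) c = p := by simp [rot, h]
    have h2 : rotBy p p ∘ rot p ∘ f = f := funext fun v => rotBy_self_rot (hf v)
    have h3 : rotBy p 0 ∘ f = f := funext fun v => rotBy_zero p _
    rw [h1, h2, h, h3, mul_zero, pow_zero, Even.neg_one_pow]
    rw [show p + p * p = p * (p + 1) by ring]
    exact Nat.even_mul_succ_self p
  · obtain ⟨s, hs⟩ := Nat.exists_eq_succ_of_ne_zero h
    have hsp : s + 1 ≤ p := by have := hf c; omega
    have h1 : (rot p ∘ f) c = s := by simp [rot, hs]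
    have h2 : rotBy p s ∘ rot p ∘ f = rotBy p (s + 1) ∘ f :=
      funext fun v => rotBy_rot hsp
    rw [h1, h2, hs, Nat.succ_eq_add_one]
    congr 2
    ring

lemma rootMap_rotMap (c : α) {p : ℕ} {x : (α → ℕ) →₀ 𝕜} (hx : x ∈ chains 𝕜 E p) :
    rootMap 𝕜 c p (rotMap 𝕜 p x) = rootMap 𝕜 c p x :=
  eqOn_chains (φ := rootMap 𝕜 c p ∘ₗ rotMap 𝕜 p) (fun _ hf => rootMap_single_rot c hf.1.1) hx

/-- The rotation commutes with the boundary up to coboundaries of the rotation. -/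
lemma bd_rotMap (hE : RefinementStable E) {p : ℕ} {f : α → ℕ} (hf : IsCell (p + 1) f) :
    bd 𝕜 E (p + 1) (rotMap 𝕜 (p + 1) (single f 1)) =
      rotMap 𝕜 p (bd 𝕜 E (p + 1) (single f 1)) +
        (term 𝕜 E (face (p + 1) 0 ∘ f) - rotMap 𝕜 p (term 𝕜 E (face (p + 1) 0 ∘ f))) := by
  -- Rotation shifts the face index by one, except that the last face becomes face `0` without
  -- rotation; this exception is the correction term.
  have h1 : ∀ i ∈ Finset.range (p + 1), (-1 : 𝕜) ^ i •
      term 𝕜 E (face (p + 1) i ∘ rot (p + 1) ∘ f) =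
        (-1 : 𝕜) ^ i • term 𝕜 E (rot p ∘ face (p + 1) (i + 1) ∘ f) := by
    intro i hi
    congr 2
    funext v
    exact face_rot (Finset.mem_range.1 hi) (hf.1 v)
  have h2 : face (p + 1) (p + 1) ∘ rot (p + 1) ∘ f = face (p + 1) 0 ∘ f :=
    funext fun v => face_last_rot (hf.1 v)
  have h3 : (-1 : 𝕜) ^ (p + 1) * (-1 : 𝕜) ^ (p + 1) = 1 := by
    rw [← pow_add]; exact Even.neg_one_pow ⟨p + 1, rfl⟩
  rw [rotMap_single, map_smul, bd_single, bd_single, Finset.sum_range_succ, Finset.sum_congr rfl h1,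
    h2, smul_add, smul_smul, h3, one_smul, map_sum, Finset.sum_range_succ' _ (p + 1)]
  simp only [map_smul, rotMap_term 𝕜 hE hf.face.1, Finset.smul_sum, smul_smul, pow_zero, one_smul]
  have h4 : ∀ i : ℕ, (-1 : 𝕜) ^ (p + 1) * (-1 : 𝕜) ^ i = (-1 : 𝕜) ^ (i + 1) * (-1 : 𝕜) ^ p :=
    fun i => by ring
  simp only [h4]
  abel

/-- The words with position `0` attained. -/
def IsFull (E : (α → ℕ) → Prop) (p : ℕ) (f : α → ℕ) : Prop :=
  IsCell p f ∧ (∃ v, f v = 0) ∧ E f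

/-- Position `0` has to be attained because a nontrivial rotation moves it to a positive position,
where cells need a nonempty block. -/
lemma IsFull.rotBy (hE : RefinementStable E) {p s : ℕ} (hs : s ≤ p) {f : α → ℕ}
    (hf : IsFull E p f) : IsFull E p (rotBy p s ∘ f) := by
  obtain ⟨⟨h1, h2⟩, h3, h4⟩ := hf
  have hsurj : ∀ j ≤ p, ∃ v, f v = j := fun j hj => by
    rcases Nat.eq_zero_or_pos j with rfl | h
    · exact h3
    · exact h2 j h hj
  have hsurj' : ∀ j ≤ p, ∃ v, (CyclicColoring.rotBy p s ∘ f) v = j := fun j hj => by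
    obtain ⟨x, hx, rfl⟩ := rotBy_surj hs hj
    obtain ⟨v, rfl⟩ := hsurj x hx
    exact ⟨v, rfl⟩
  exact ⟨⟨fun v => rotBy_le hs (h1 v), fun j _ => hsurj' j⟩, hsurj' 0 (zero_le),
    (hE.rotBy_iff hs h1).2 h4⟩

lemma IsFull.mem_cells {p : ℕ} {f : α → ℕ} (hf : IsFull E p f) : f ∈ cells E p :=
  ⟨hf.1, hf.2.2⟩

/-- The correction in `bd_rotMap` is a difference of a chain and its rotation, which `rootMap`
kills. -/
lemma rootMap_bd_rotMap (hE : RefinementStable E) (c : α) {p : ℕ} {f : α → ℕ}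
    (hf : f ∈ cells E (p + 1)) :
    rootMap 𝕜 c p (bd 𝕜 E (p + 1) (rotMap 𝕜 (p + 1) (single f 1))) =
      rootMap 𝕜 c p (bd 𝕜 E (p + 1) (single f 1)) := by
  rw [bd_rotMap hE hf.1, map_add, map_sub, rootMap_rotMap c (bd_mem_chains (single_mem_chains hf)),
    rootMap_rotMap c (term_mem_chains hf.1.face), sub_self, add_zero]

lemma rootMap_bd_rotBy (hE : RefinementStable E) (c : α) {p s : ℕ} (hs : s ≤ p + 1) {f : α → ℕ}
    (hf : IsFull E (p + 1) f) :
    (-1 : 𝕜) ^ ((p + 1) * s) •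
        rootMap 𝕜 c p (bd 𝕜 E (p + 1) (single (rotBy (p + 1) s ∘ f) 1)) =
      rootMap 𝕜 c p (bd 𝕜 E (p + 1) (single f 1)) := by
  induction s with
  | zero =>
    have : rotBy (p + 1) 0 ∘ f = f := funext fun v => rotBy_zero _ _
    simp [this]
  | succ s ih =>
    have h : rot (p + 1) ∘ rotBy (p + 1) s ∘ f = rotBy (p + 1) (s + 1) ∘ f :=
      funext fun v => rot_rotBy hs
    have key := rootMap_bd_rotMap (𝕜 := 𝕜) hE c (hf.rotBy hE (s := s) (by omega)).mem_cells
    rw [rotMap_single, h, map_smul, map_smul] at key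
    rw [← ih (by omega), ← key, smul_smul, ← pow_add, mul_add_one]

lemma rootMap_rotBy (hE : RefinementStable E) (c : α) {p s : ℕ} (hs : s ≤ p) {f : α → ℕ}
    (hf : IsFull E p f) :
    (-1 : 𝕜) ^ (p * s) • rootMap 𝕜 c p (single (rotBy p s ∘ f) 1) =
      rootMap 𝕜 c p (single f 1) := by
  induction s with
  | zero =>
    have : rotBy p 0 ∘ f = f := funext fun v => rotBy_zero _ _
    rw [this, mul_zero, pow_zero, one_smul]
  | succ s ih =>
    have h : rot p ∘ rotBy p s ∘ f = rotBy p (s + 1) ∘ f :=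
      funext fun v => rot_rotBy hs
    have key := rootMap_single_rot (𝕜 := 𝕜) c (hf.rotBy hE (s := s) (by omega)).1.1
    rw [rotMap_single, h, map_smul] at key
    rw [← ih (by omega), ← key, smul_smul, ← pow_add, mul_add_one]

lemma isFull_of_rooted {c : α} {p : ℕ} {f : α → ℕ} (hf : f ∈ cells (rooted E c) p) :
    IsFull E p f := ⟨hf.1, ⟨c, hf.2.1⟩, hf.2.2⟩

lemma rootMap_single_of_rooted (c : α) (p : ℕ) {f : α → ℕ} (hf : f c = 0) :
    rootMap 𝕜 c p (single f 1) = single f 1 := by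
  have : rotBy p 0 ∘ f = f := funext fun v => rotBy_zero _ _
  rw [rootMap_single, hf, this, mul_zero, pow_zero, one_smul]

lemma rootMap_of_mem_rooted {c : α} {p : ℕ} {x : (α → ℕ) →₀ 𝕜}
    (hx : x ∈ chains 𝕜 (rooted E c) p) : rootMap 𝕜 c p x = x :=
  eqOn_chains (ψ := LinearMap.id) (fun _ hf => rootMap_single_of_rooted c p hf.2.1) hx

lemma bd_rooted {c : α} {p : ℕ} {x : (α → ℕ) →₀ 𝕜}
    (hx : x ∈ chains 𝕜 (rooted E c) p) : bd 𝕜 (rooted E c) p x = bd 𝕜 E p x := by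
  refine eqOn_chains (fun f hf => ?_) hx
  rw [bd_single, bd_single]
  refine Finset.sum_congr rfl fun i _ => ?_
  have hc : (face p i ∘ f) c = 0 := by simp [hf.2.1, face_zero]
  congr 1
  by_cases h : E (face p i ∘ f)
  · rw [term_of 𝕜 h, term_of 𝕜 (G := rooted E c) ⟨hc, h⟩]
  · rw [term_of_not 𝕜 h, term_of_not 𝕜 (G := rooted E c) fun h' => h h'.2]

lemma rootMap_mem (hE : RefinementStable E) (c d : α) {p : ℕ} {x : (α → ℕ) →₀ 𝕜}
    (hx : x ∈ chains 𝕜 (rooted E d) p) : rootMap 𝕜 c p x ∈ chains 𝕜 (rooted E c) p := by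
  suffices h : chains 𝕜 (rooted E d) p ≤ (chains 𝕜 (rooted E c) p).comap (rootMap 𝕜 c p) from h hx
  refine chains_le fun f hf => ?_
  rw [Submodule.mem_comap, rootMap_single]
  have := (isFull_of_rooted hf).rotBy hE (hf.1.1 c)
  exact Submodule.smul_mem _ _ (single_mem_chains ⟨this.1, rotBy_self _ _, this.2.2⟩)

lemma bd_rootMap (hE : RefinementStable E) (c d : α) {p : ℕ} {x : (α → ℕ) →₀ 𝕜}
    (hx : x ∈ chains 𝕜 (rooted E d) (p + 1)) :
    bd 𝕜 (rooted E c) (p + 1) (rootMap 𝕜 c (p + 1) x) =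
      rootMap 𝕜 c p (bd 𝕜 (rooted E d) (p + 1) x) := by
  -- The left side is already rooted at `c`, so applying `rootMap` to it changes nothing and makes
  -- rotation invariance available.
  rw [bd_rooted hx, ← rootMap_of_mem_rooted (bd_mem_chains (rootMap_mem hE c d hx)),
    bd_rooted (rootMap_mem hE c d hx)]
  refine eqOn_chains (φ := rootMap 𝕜 c p ∘ₗ bd 𝕜 E (p + 1) ∘ₗ rootMap 𝕜 c (p + 1))
    (ψ := rootMap 𝕜 c p ∘ₗ bd 𝕜 E (p + 1)) (fun f hf => ?_) hx
  simp only [LinearMap.comp_apply, rootMap_single, map_smul]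
  exact rootMap_bd_rotBy hE c (hf.1.1 c) (isFull_of_rooted hf)

lemma rootMap_rootMap (hE : RefinementStable E) (c d : α) {p : ℕ} {x : (α → ℕ) →₀ 𝕜}
    (hx : x ∈ chains 𝕜 (rooted E c) p) : rootMap 𝕜 c p (rootMap 𝕜 d p x) = x := by
  refine eqOn_chains (φ := rootMap 𝕜 c p ∘ₗ rootMap 𝕜 d p) (ψ := LinearMap.id) (fun f hf => ?_) hx
  rw [LinearMap.comp_apply, rootMap_single, map_smul,
    rootMap_rotBy hE c (hf.1.1 d) (isFull_of_rooted hf), rootMap_single_of_rooted c p hf.2.1,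
    LinearMap.id_apply]

/-- Rerooting at `c` maps onto these cycles, with rerooting at `d` as a section; exchanging `c` and
`d` gives equality. -/
lemma finrank_cycles_rooted_le [Finite α] (hE : RefinementStable E) (c d : α) (p : ℕ) :
    Module.finrank 𝕜 (cycles 𝕜 (rooted E c) (p + 1)) ≤
      Module.finrank 𝕜 (cycles 𝕜 (rooted E d) (p + 1)) := by
  refine le_trans (Submodule.finrank_mono ?_)
    (Submodule.finrank_map_le (rootMap 𝕜 c (p + 1)) (cycles 𝕜 (rooted E d) (p + 1)))
  rintro x ⟨hx, hx'⟩
  refine ⟨rootMap 𝕜 d (p + 1) x, ⟨rootMap_mem hE d c hx, LinearMap.mem_ker.2 ?_⟩,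
    rootMap_rootMap hE c d hx⟩
  rw [bd_rootMap hE d c hx, LinearMap.mem_ker.1 hx', map_zero]

lemma finrank_boundaries_rooted_le [Finite α] (hE : RefinementStable E) (c d : α) (p : ℕ) :
    Module.finrank 𝕜 (boundaries 𝕜 (rooted E c) p) ≤
      Module.finrank 𝕜 (boundaries 𝕜 (rooted E d) p) := by
  refine le_trans (Submodule.finrank_mono ?_)
    (Submodule.finrank_map_le (rootMap 𝕜 c p) (boundaries 𝕜 (rooted E d) p))
  rintro _ ⟨x, hx, rfl⟩
  refine ⟨_, ⟨rootMap 𝕜 d (p + 1) x, rootMap_mem hE d c hx, rfl⟩, ?_⟩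
  rw [← bd_rootMap hE c d (rootMap_mem hE d c hx), rootMap_rootMap hE c d hx]

end Rotation

/-! ### Deleting the root vertex. -/

section Unrooting

variable {N : ℕ}

/-- Add the vertex `c`, in position `0`, to a word. -/
def insertZero (c : Fin (N + 1)) (g : Fin N → ℕ) : Fin (N + 1) → ℕ := c.insertNth 0 g

/-- The predicate on words without the vertex `c` induced by putting `c` in position `0`. -/
def unrooted (E : (Fin (N + 1) → ℕ) → Prop) (c : Fin (N + 1)) (g : Fin N → ℕ) : Prop :=
  E (insertZero c g)

@[simp] lemma insertZero_same (c : Fin (N + 1)) (g : Fin N → ℕ) : insertZero c g c = 0 := by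
  simp [insertZero]

@[simp] lemma insertZero_succAbove (c : Fin (N + 1)) (g : Fin N → ℕ) (v : Fin N) :
    insertZero c g (c.succAbove v) = g v := by
  simp [insertZero]

lemma insertZero_injective (c : Fin (N + 1)) : Function.Injective (insertZero c) := by
  intro g g' h
  funext v
  simpa using congrFun h (c.succAbove v)

lemma comp_insertZero {φ : ℕ → ℕ} (hφ : φ 0 = 0) (c : Fin (N + 1)) (g : Fin N → ℕ) :
    φ ∘ insertZero c g = insertZero c (φ ∘ g) := by
  funext v
  refine c.succAboveCases ?_ (fun v => ?_) v <;> simp [hφ]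

lemma isCell_insertZero {c : Fin (N + 1)} {p : ℕ} {g : Fin N → ℕ} :
    IsCell p (insertZero c g) ↔ IsCell p g := by
  simp only [IsCell, Fin.forall_iff_succAbove c, Fin.exists_iff_succAbove c, insertZero_same,
    insertZero_succAbove]
  refine ⟨fun h => ⟨h.1.2, fun j h1 h2 => (h.2 j h1 h2).resolve_left (by omega)⟩,
    fun h => ⟨⟨zero_le, h.1⟩, fun j h1 h2 => Or.inr (h.2 j h1 h2)⟩⟩

lemma image_insertZero_cells (E : (Fin (N + 1) → ℕ) → Prop) (c : Fin (N + 1)) (p : ℕ) :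
    insertZero c '' cells (unrooted E c) p = cells (rooted E c) p := by
  ext f
  constructor
  · rintro ⟨g, hg, rfl⟩
    exact ⟨isCell_insertZero.2 hg.1, insertZero_same c g, hg.2⟩
  · intro hf
    have h : insertZero c (fun v => f (c.succAbove v)) = f := by
      funext v
      refine c.succAboveCases ?_ (fun v => ?_) v
      · rw [insertZero_same, hf.2.1]
      · rw [insertZero_succAbove]
    refine ⟨fun v => f (c.succAbove v), ⟨(isCell_insertZero (c := c)).1 ?_, ?_⟩, h⟩
    · rw [h]; exact hf.1
    · rw [unrooted, h]; exact hf.2.2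

variable (𝕜 : Type*) [Field 𝕜] (E : (Fin (N + 1) → ℕ) → Prop) (c : Fin (N + 1))

lemma map_insertZero_chains (p : ℕ) :
    (chains 𝕜 (unrooted E c) p).map (lmapDomain 𝕜 𝕜 (insertZero c)) =
      chains 𝕜 (rooted E c) p := by
  rw [chains, lmapDomain_supported, image_insertZero_cells, chains]

lemma term_insertZero (g : Fin N → ℕ) :
    term 𝕜 (rooted E c) (insertZero c g) =
      lmapDomain 𝕜 𝕜 (insertZero c) (term 𝕜 (unrooted E c) g) := by
  by_cases h : unrooted E c g
  · rw [term_of 𝕜 h, term_of 𝕜 (G := rooted E c) ⟨insertZero_same c g, h⟩]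
    simp
  · rw [term_of_not 𝕜 h, term_of_not 𝕜 (G := rooted E c) fun h' => h h'.2, map_zero]

variable {𝕜}

lemma bd_insertZero (p : ℕ) (x : (Fin N → ℕ) →₀ 𝕜) :
    bd 𝕜 (rooted E c) p (lmapDomain 𝕜 𝕜 (insertZero c) x) =
      lmapDomain 𝕜 𝕜 (insertZero c) (bd 𝕜 (unrooted E c) p x) := by
  suffices bd 𝕜 (rooted E c) p ∘ₗ lmapDomain 𝕜 𝕜 (insertZero c) =
      lmapDomain 𝕜 𝕜 (insertZero c) ∘ₗ bd 𝕜 (unrooted E c) p from LinearMap.congr_fun this x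
  refine lhom_ext' fun g => LinearMap.ext_ring ?_
  rw [LinearMap.comp_apply, LinearMap.comp_apply, LinearMap.comp_apply, LinearMap.comp_apply,
    lsingle_apply, lmapDomain_apply, mapDomain_single, bd_single, bd_single, map_sum]
  simp only [map_smul, comp_insertZero (face_zero _ _), term_insertZero]

variable (𝕜)

lemma insertZero_lmapDomain_injective :
    Function.Injective (lmapDomain 𝕜 𝕜 (insertZero c)) :=
  mapDomain_injective (insertZero_injective c)

lemma finrank_boundaries_unrooted (p : ℕ) :
    Module.finrank 𝕜 (boundaries 𝕜 (unrooted E c) p) =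
      Module.finrank 𝕜 (boundaries 𝕜 (rooted E c) p) := by
  have h : (boundaries 𝕜 (unrooted E c) p).map (lmapDomain 𝕜 𝕜 (insertZero c)) =
      boundaries 𝕜 (rooted E c) p := by
    rw [boundaries, boundaries, ← map_insertZero_chains, ← Submodule.map_comp,
      ← Submodule.map_comp]
    congr 1
    exact LinearMap.ext fun x => (bd_insertZero E c _ x).symm
  rw [← h]
  exact (Submodule.equivMapOfInjective _ (insertZero_lmapDomain_injective 𝕜 c) _).finrank_eq

lemma finrank_cycles_unrooted (p : ℕ) :
    Module.finrank 𝕜 (cycles 𝕜 (unrooted E c) (p + 1)) =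
      Module.finrank 𝕜 (cycles 𝕜 (rooted E c) (p + 1)) := by
  have h : (cycles 𝕜 (unrooted E c) (p + 1)).map (lmapDomain 𝕜 𝕜 (insertZero c)) =
      cycles 𝕜 (rooted E c) (p + 1) := by
    apply le_antisymm
    · rintro _ ⟨x, hx, rfl⟩
      refine ⟨map_insertZero_chains 𝕜 E c _ ▸ Submodule.mem_map_of_mem hx.1,
        LinearMap.mem_ker.2 ?_⟩
      rw [bd_insertZero, LinearMap.mem_ker.1 hx.2, map_zero]
    · rintro x ⟨hx, hx'⟩
      have hx2 : x ∈ chains 𝕜 (rooted E c) (p + 1) := hx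
      rw [← map_insertZero_chains] at hx2
      obtain ⟨y, hy, rfl⟩ := hx2
      refine ⟨y, ⟨hy, LinearMap.mem_ker.2 (insertZero_lmapDomain_injective 𝕜 c ?_)⟩, rfl⟩
      rw [← bd_insertZero, LinearMap.mem_ker.1 hx', map_zero]
  rw [← h]
  exact (Submodule.equivMapOfInjective _ (insertZero_lmapDomain_injective 𝕜 c) _).finrank_eq

end Unrooting

/-! ### Ordered partitions as words. -/

section Partitions

variable (𝕜 : Type*) [Field 𝕜] {n b : ℕ}

/-- No edge of `H` lies in a block of the word `f`. -/
def NoEdge (H : Hypergraph (Fin n)) (f : Fin n → ℕ) : Prop :=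
  ∀ e ∈ H.edgeSet, ¬ ∀ u ∈ e, ∀ v ∈ e, f u = f v

lemma NoEdge.refinementStable (H : Hypergraph (Fin n)) : RefinementStable (NoEdge H) :=
  fun _ _ h hf' e he hc => hf' e he fun u hu v hv => h u v (hc u hu v hv)

/-- The positions of the vertices. -/
def CyclicPartition.word (P : CyclicPartition n b) (v : Fin n) : ℕ := P.pos v

lemma CyclicPartition.word_injective :
    Function.Injective (CyclicPartition.word : CyclicPartition n b → Fin n → ℕ) := by
  rintro ⟨f, _, _⟩ ⟨g, _, _⟩ h
  have : f = g := funext fun v => Fin.ext (congrFun h v)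
  subst this
  rfl

lemma CyclicPartition.word_merge (P : CyclicPartition n (b + 2)) (i : Fin (b + 2)) :
    (P.merge i).word = face (b + 1) i ∘ P.word := by
  funext v
  exact mergePos_val i (P.pos v) (Nat.succ_pos b)

lemma CyclicPartition.noEdge_word_iff (P : CyclicPartition n (b + 1)) (H : Hypergraph (Fin n)) :
    NoEdge H P.word ↔ ¬ P.HasEdge H := by
  constructor
  · rintro h ⟨e, he, j, hj⟩
    refine h e he fun u hu v hv => ?_
    have hu : P.pos u = j := hj hu
    have hv : P.pos v = j := hj hv
    simp [word, hu, hv]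
  · intro h e he hc
    refine h ⟨e, he, ?_⟩
    by_cases hne : e.Nonempty
    · obtain ⟨u, hu⟩ := hne
      exact ⟨P.pos u, fun v hv => Fin.ext (hc v hv u hu)⟩
    -- An empty edge lies in any block, and the index `b + 1` guarantees that there is one.
    · rw [Set.not_nonempty_iff_eq_empty.1 hne]
      exact ⟨0, Set.empty_subset _⟩

instance : Finite (CyclicPartition n b) :=
  Finite.of_injective CyclicPartition.pos fun P Q h =>
    CyclicPartition.word_injective (funext fun v => by simp [CyclicPartition.word, h])

variable {N : ℕ} (H : Hypergraph (Fin (N + 1)))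

lemma range_word (p : ℕ) :
    Set.range (CyclicPartition.word : CyclicPartition (N + 1) (p + 1) → Fin (N + 1) → ℕ) =
      {f | IsCell p f ∧ f 0 = 0} := by
  ext f
  constructor
  · rintro ⟨P, rfl⟩
    refine ⟨⟨fun v => Nat.lt_succ_iff.1 (P.pos v).isLt, fun j _ hj => ?_⟩, P.pos_first 0 rfl⟩
    obtain ⟨v, hv⟩ := P.surjective ⟨j, by omega⟩
    exact ⟨v, by simp [CyclicPartition.word, hv]⟩
  · rintro ⟨hf, h0⟩
    refine ⟨⟨fun v => ⟨f v, Nat.lt_succ_iff.2 (hf.1 v)⟩, ?_, ?_⟩, rfl⟩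
    · rintro ⟨j, hj⟩
      rcases Nat.eq_zero_or_pos j with rfl | hj0
      · exact ⟨0, Fin.ext h0⟩
      · obtain ⟨v, hv⟩ := hf.2 j hj0 (by omega)
        exact ⟨v, Fin.ext hv⟩
    · intro v hv
      have : v = 0 := Fin.ext hv
      rw [this]
      exact h0

/-- Ordered partitions as words, with those containing an edge sent to zero. -/
def wordMap (b : ℕ) : Chain 𝕜 (N + 1) b →ₗ[𝕜] ((Fin (N + 1) → ℕ) →₀ 𝕜) :=
  linearCombination 𝕜 fun P => term 𝕜 (NoEdge H) P.word

end Partitions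

/-! ### The quotient complex as a complex of words. -/

section Quotient

variable (𝕜 : Type*) [Field 𝕜] {N : ℕ} (H : Hypergraph (Fin (N + 1)))

lemma wordMap_single {b : ℕ} (P : CyclicPartition (N + 1) b) :
    wordMap 𝕜 H b (single P 1) = term 𝕜 (NoEdge H) P.word := by
  simp [wordMap]

lemma wordMap_boundary (r : ℕ) (x : Chain 𝕜 (N + 1) (r + 2)) :
    wordMap 𝕜 H (r + 1) (boundary 𝕜 (N + 1) r x) =
      bd 𝕜 (NoEdge H) (r + 1) (wordMap 𝕜 H (r + 2) x) := by
  suffices wordMap 𝕜 H (r + 1) ∘ₗ boundary 𝕜 (N + 1) r =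
      bd 𝕜 (NoEdge H) (r + 1) ∘ₗ wordMap 𝕜 H (r + 2) from LinearMap.congr_fun this x
  refine lhom_ext' fun P => LinearMap.ext_ring ?_
  simp only [LinearMap.comp_apply, lsingle_apply, boundary_single, wordMap_single, map_sum,
    map_smul, CyclicPartition.word_merge, bd_apply,
    faceMap_term fun _ _ _ => NoEdge.refinementStable H _ _ fun _ _ h => congrArg (face _ _) h]
  rw [Finset.sum_range]

lemma coloringChain_le_ker (b : ℕ) :
    coloringChain 𝕜 H (b + 1) ≤ LinearMap.ker (wordMap 𝕜 H (b + 1)) := by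
  refine Submodule.span_le.2 ?_
  rintro _ ⟨P, hP, rfl⟩
  rw [SetLike.mem_coe, LinearMap.mem_ker, wordMap_single, term_of_not]
  rw [P.noEdge_word_iff, not_not]
  exact hP

/-- The isomorphism from the quotient chains to the chains of words without an edge in a block. -/
def complWordMap (b : ℕ) :
    ComplChain 𝕜 H (b + 1) →ₗ[𝕜] ((Fin (N + 1) → ℕ) →₀ 𝕜) :=
  (coloringChain 𝕜 H (b + 1)).liftQ (wordMap 𝕜 H (b + 1)) (coloringChain_le_ker 𝕜 H b)

lemma complWordMap_mkQ (b : ℕ) (x : Chain 𝕜 (N + 1) (b + 1)) :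
    complWordMap 𝕜 H b ((coloringChain 𝕜 H (b + 1)).mkQ x) = wordMap 𝕜 H (b + 1) x := rfl

/-- Reading off the coefficients at words of partitions gives a left inverse: partitions with an
edge are zero on both sides. -/
lemma complWordMap_injective (b : ℕ) : Function.Injective (complWordMap 𝕜 H b) := by
  let ψ : ((Fin (N + 1) → ℕ) →₀ 𝕜) →ₗ[𝕜] ComplChain 𝕜 H (b + 1) :=
    (coloringChain 𝕜 H (b + 1)).mkQ ∘ₗ lcomapDomain _ CyclicPartition.word_injective
  have h : ψ ∘ₗ complWordMap 𝕜 H b = LinearMap.id := by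
    refine Submodule.linearMap_qext _ (lhom_ext' fun P => LinearMap.ext_ring ?_)
    simp only [LinearMap.comp_apply, lsingle_apply, complWordMap_mkQ, wordMap_single,
      LinearMap.id_apply, ψ]
    by_cases hP : P.HasEdge H
    · rw [term_of_not 𝕜 (by rw [P.noEdge_word_iff, not_not]; exact hP), map_zero, map_zero,
        eq_comm, Submodule.mkQ_apply, Submodule.Quotient.mk_eq_zero]
      exact Submodule.subset_span ⟨P, hP, rfl⟩
    · rw [term_of 𝕜 ((P.noEdge_word_iff H).2 hP)]
      congr 1
      exact comapDomain_single _ _ _ _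
  exact Function.LeftInverse.injective (g := ψ) fun x => LinearMap.congr_fun h x

lemma range_complWordMap (p : ℕ) :
    LinearMap.range (complWordMap 𝕜 H p) = chains 𝕜 (rooted (NoEdge H) 0) p := by
  rw [complWordMap, Submodule.range_liftQ]
  apply le_antisymm
  · rw [wordMap, range_linearCombination, Submodule.span_le]
    rintro _ ⟨P, rfl⟩
    have hP : P.word ∈ {f | IsCell p f ∧ f 0 = 0} := range_word p ▸ Set.mem_range_self P
    by_cases h : NoEdge H P.word
    · dsimp only
      rw [term_of 𝕜 h]
      exact single_mem_chains ⟨hP.1, hP.2, h⟩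
    · dsimp only
      rw [term_of_not 𝕜 h]
      exact zero_mem _
  · refine chains_le fun f hf => ?_
    have hf' : f ∈ Set.range (CyclicPartition.word : CyclicPartition (N + 1) (p + 1) → _) := by
      rw [range_word]
      exact ⟨hf.1, hf.2.1⟩
    obtain ⟨P, rfl⟩ := hf'
    exact ⟨single P 1, by rw [wordMap_single, term_of 𝕜 hf.2.2]⟩

lemma complWordMap_complBoundary (r : ℕ) (x : ComplChain 𝕜 H (r + 2)) :
    complWordMap 𝕜 H r (complBoundary 𝕜 H r x) =
      bd 𝕜 (rooted (NoEdge H) 0) (r + 1) (complWordMap 𝕜 H (r + 1) x) := by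
  rw [bd_rooted (range_complWordMap 𝕜 H (r + 1) ▸ LinearMap.mem_range_self _ x)]
  obtain ⟨x, rfl⟩ := Submodule.mkQ_surjective _ x
  exact wordMap_boundary 𝕜 H r x

lemma finrank_ker_complBoundary (r : ℕ) :
    Module.finrank 𝕜 (LinearMap.ker (complBoundary 𝕜 H r)) =
      Module.finrank 𝕜 (cycles 𝕜 (rooted (NoEdge H) 0) (r + 1)) := by
  have h : (LinearMap.ker (complBoundary 𝕜 H r)).map (complWordMap 𝕜 H (r + 1)) =
      cycles 𝕜 (rooted (NoEdge H) 0) (r + 1) := by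
    apply le_antisymm
    · rintro _ ⟨x, hx, rfl⟩
      refine ⟨range_complWordMap 𝕜 H (r + 1) ▸ LinearMap.mem_range_self _ x,
        LinearMap.mem_ker.2 ?_⟩
      rw [← complWordMap_complBoundary, LinearMap.mem_ker.1 hx, map_zero]
    · rintro x ⟨hx, hx'⟩
      have hx2 : x ∈ chains 𝕜 (rooted (NoEdge H) 0) (r + 1) := hx
      rw [← range_complWordMap] at hx2
      obtain ⟨y, rfl⟩ := hx2
      refine ⟨y, LinearMap.mem_ker.2 (complWordMap_injective 𝕜 H r ?_), rfl⟩
      rw [complWordMap_complBoundary, LinearMap.mem_ker.1 hx', map_zero]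
  rw [← h]
  exact (Submodule.equivMapOfInjective _ (complWordMap_injective 𝕜 H _) _).finrank_eq

lemma finrank_range_complBoundary (r : ℕ) :
    Module.finrank 𝕜 (LinearMap.range (complBoundary 𝕜 H r)) =
      Module.finrank 𝕜 (boundaries 𝕜 (rooted (NoEdge H) 0) r) := by
  have h : (LinearMap.range (complBoundary 𝕜 H r)).map (complWordMap 𝕜 H r) =
      boundaries 𝕜 (rooted (NoEdge H) 0) r := by
    rw [boundaries, ← range_complWordMap, ← LinearMap.range_comp, ← LinearMap.range_comp]
    congr 1
    exact LinearMap.ext fun x => complWordMap_complBoundary 𝕜 H r x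
  rw [← h]
  exact (Submodule.equivMapOfInjective _ (complWordMap_injective 𝕜 H _) _).finrank_eq

lemma finrank_complHomology_add (r : ℕ) :
    Module.finrank 𝕜 (ComplHomology 𝕜 H r) +
        Module.finrank 𝕜 (boundaries 𝕜 (rooted (NoEdge H) 0) (r + 1)) =
      Module.finrank 𝕜 (cycles 𝕜 (rooted (NoEdge H) 0) (r + 1)) := by
  rw [← finrank_range_complBoundary, ← finrank_ker_complBoundary,
    ← (Submodule.submoduleOfEquivOfLe (range_complBoundary_le_ker 𝕜 H r)).finrank_eq]
  exact Submodule.finrank_quotient_add_finrank _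

/-- Every edge contains `c`, so the only block that can contain an edge is that of `c`, in position
`0`. -/
lemma hereditary_unrooted_noEdge {c : Fin (N + 1)} (hc : ∀ e ∈ H.edgeSet, c ∈ e) :
    Hereditary (unrooted (NoEdge H) c) := by
  intro f f' h hf' e he hconst
  have hz : ∀ u ∈ e, insertZero c f' u = 0 := by
    intro u hu
    have h0 : insertZero c f u = 0 := (hconst u hu c (hc e he)).trans (insertZero_same c f)
    revert h0
    refine c.succAboveCases ?_ (fun v => ?_) u
    · simp
    · rw [insertZero_succAbove, insertZero_succAbove]
      exact h v
  exact hf' e he fun u hu v hv => (hz u hu).trans (hz v hv).symm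

/-- If all edges of `H` share a vertex `c`, the homology of the complement of the cyclic coloring
complex is counted by the sets of vertices other than `c` that meet every edge. -/
theorem finrank_complHomology {c : Fin (N + 1)} (hc : ∀ e ∈ H.edgeSet, c ∈ e) (r : ℕ) :
    Module.finrank 𝕜 (ComplHomology 𝕜 H r) =
      (criticalSets (unrooted (NoEdge H) c) (r + 1)).card := by
  have h1 := finrank_complHomology_add 𝕜 H r
  have h2 := finrank_cycles 𝕜 (hereditary_unrooted_noEdge H hc) (r + 1)
  have hE := NoEdge.refinementStable H
  have h3 := (finrank_cycles_rooted_le (𝕜 := 𝕜) hE 0 c r).antisymm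
    (finrank_cycles_rooted_le hE c 0 r)
  have h4 := (finrank_boundaries_rooted_le (𝕜 := 𝕜) hE 0 c (r + 1)).antisymm
    (finrank_boundaries_rooted_le hE c 0 (r + 1))
  rw [finrank_cycles_unrooted, finrank_boundaries_unrooted] at h2
  omega

end Quotient

/-! ### Counting sets that miss an interval. -/

section Intervals

variable {n k : ℕ}

open Classical in
/-- The sets of `p` vertices that miss an interval of length `k`. -/
def missingSets (n k p : ℕ) : Finset (Finset (Fin n)) :=
  {A | A.card = p ∧ ∃ i, i + k ≤ n ∧ ∀ x ∈ A, ¬ (i ≤ (x : ℕ) ∧ (x : ℕ) < i + k)}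

lemma card_filter_notMem_interval {i m : ℕ} (h : i + m ≤ n) :
    (Finset.univ.filter fun x : Fin n => ¬ (i ≤ (x : ℕ) ∧ (x : ℕ) < i + m)).card = n - m := by
  have h1 : ((Finset.univ.filter fun x : Fin n => i ≤ (x : ℕ) ∧ (x : ℕ) < i + m).map
      Fin.valEmbedding) = Finset.Ico i (i + m) := by
    ext y
    simp only [Finset.mem_map, Finset.mem_filter, Finset.mem_univ, true_and,
      Fin.valEmbedding_apply, Finset.mem_Ico]
    constructor
    · rintro ⟨x, hx, rfl⟩
      exact hx
    · intro hy
      exact ⟨⟨y, by omega⟩, hy, rfl⟩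
  have h2 := congrArg Finset.card h1
  rw [Finset.card_map, Nat.card_Ico] at h2
  have h3 := Finset.card_filter_add_card_filter_not (s := (Finset.univ : Finset (Fin n)))
    (fun x : Fin n => i ≤ (x : ℕ) ∧ (x : ℕ) < i + m)
  rw [Finset.card_univ, Fintype.card_fin] at h3
  omega

open Classical in
/-- The sets of `p` vertices for which `i` is the first position of an interval of length `k`
that they miss, when any two such intervals meet. -/
def firstMissingSets (n k p i : ℕ) : Finset (Finset (Fin n)) :=
  {A | A.card = p ∧ (∀ x ∈ A, ¬ (i ≤ (x : ℕ) ∧ (x : ℕ) < i + k)) ∧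
    ∀ j, i = j + 1 → ∃ x ∈ A, (x : ℕ) = j}

lemma card_firstMissingSets_zero (hk : k ≤ n) (p : ℕ) :
    (firstMissingSets n k p 0).card = (n - k).choose p := by
  rw [← card_filter_notMem_interval (i := 0) (m := k) (by omega), ← Finset.card_powersetCard]
  congr 1
  ext A
  simp only [firstMissingSets, Finset.mem_filter, Finset.mem_univ, true_and,
    Finset.mem_powersetCard, Finset.subset_iff]
  exact ⟨fun h => ⟨h.2.1, h.1⟩, fun h => ⟨h.2, h.1, fun j hj => by omega⟩⟩

/-- The vertex `j` is forced, and the other `p` are free outside the `k + 1` vertices starting at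
`j`. -/
lemma card_firstMissingSets_succ {j : ℕ} (hj : j + 1 + k ≤ n) (p : ℕ) :
    (firstMissingSets n k (p + 1) (j + 1)).card = (n - k - 1).choose p := by
  let J : Finset (Fin n) :=
    Finset.univ.filter fun x : Fin n => ¬ (j ≤ (x : ℕ) ∧ (x : ℕ) < j + (k + 1))
  let y : Fin n := ⟨j, by omega⟩
  have hy : ∀ B ∈ Finset.powersetCard p J, y ∉ B := fun B hB hyB => by
    have := (Finset.mem_filter.1 ((Finset.mem_powersetCard.1 hB).1 hyB)).2
    simp only [y] at this
    omega
  have h : firstMissingSets n k (p + 1) (j + 1) = (Finset.powersetCard p J).image (insert y) := by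
    ext A
    simp only [firstMissingSets, Finset.mem_filter, Finset.mem_univ, true_and, Finset.mem_image]
    constructor
    · rintro ⟨hA, hA', hA''⟩
      obtain ⟨x, hx, hxj⟩ := hA'' j rfl
      obtain rfl : x = y := Fin.ext hxj
      refine ⟨A.erase y, Finset.mem_powersetCard.2 ⟨fun z hz => ?_, ?_⟩, Finset.insert_erase hx⟩
      · obtain ⟨hz, hz'⟩ := Finset.mem_erase.1 hz
        have h1 := hA' z hz'
        have h2 : (z : ℕ) ≠ j := fun h => hz (Fin.ext h)
        simp only [J, Finset.mem_filter, Finset.mem_univ, true_and]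
        omega
      · rw [Finset.card_erase_of_mem hx, hA, Nat.add_sub_cancel]
    · rintro ⟨B, hB, rfl⟩
      refine ⟨?_, fun x hx => ?_, fun i hi => ⟨y, Finset.mem_insert_self _ _, ?_⟩⟩
      · rw [Finset.card_insert_of_notMem (hy B hB), (Finset.mem_powersetCard.1 hB).2]
      · rcases Finset.mem_insert.1 hx with rfl | hx
        · simp only [y]
          omega
        · have := (Finset.mem_filter.1 ((Finset.mem_powersetCard.1 hB).1 hx)).2
          omega
      · simp only [y]
        omega
  rw [h, Finset.card_image_of_injOn, Finset.card_powersetCard,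
    card_filter_notMem_interval (by omega), Nat.sub_add_eq]
  intro B hB B' hB' hBB'
  rw [← Finset.erase_insert (hy B hB), ← Finset.erase_insert (hy B' hB')]
  exact congrArg (fun s => s.erase y) hBB'

lemma card_missingSets (hk : k ≤ n) (hn : n < 2 * k) (p : ℕ) :
    (missingSets n k (p + 1)).card =
      (n - k).choose (p + 1) + (n - k) * (n - k - 1).choose p := by
  have h : missingSets n k (p + 1) =
      (Finset.range (n - k + 1)).biUnion (firstMissingSets n k (p + 1)) := by
    ext A
    simp only [missingSets, firstMissingSets, Finset.mem_filter, Finset.mem_univ, true_and,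
      Finset.mem_biUnion, Finset.mem_range]
    constructor
    · rintro ⟨hA, hex⟩
      classical
      obtain ⟨h1, h2⟩ := Nat.find_spec hex
      refine ⟨Nat.find hex, by omega, hA, h2, fun j hj => ?_⟩
      -- By minimality the preceding interval meets `A`, and its first vertex `j` is the only one
      -- outside the missed interval.
      have := Nat.find_min hex (m := j) (by omega)
      push Not at this
      obtain ⟨x, hx, hx'⟩ := this (by omega)
      refine ⟨x, hx, ?_⟩
      have := h2 x hx
      omega
    · rintro ⟨i, hi, hA, hA', -⟩
      exact ⟨hA, i, by omega, hA'⟩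
  have hdisj : ∀ i i', i < i' → i' < n - k + 1 →
      Disjoint (firstMissingSets n k (p + 1) i) (firstMissingSets n k (p + 1) i') := by
    intro i i' hi hi'
    rw [Finset.disjoint_left]
    intro A hA hA'
    simp only [firstMissingSets, Finset.mem_filter, Finset.mem_univ, true_and] at hA hA'
    -- The vertex `i' - 1` of `A` lies in the interval starting at `i`, because `i' ≤ n - k < k`.
    obtain ⟨x, hx, hx'⟩ := hA'.2.2 (i' - 1) (by omega)
    have := hA.2.1 x hx
    omega
  rw [h, Finset.card_biUnion, Finset.sum_range_succ', card_firstMissingSets_zero hk,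
    Finset.sum_congr rfl fun j hj => card_firstMissingSets_succ
      (by have := Finset.mem_range.1 hj; omega) p, Finset.sum_const, Finset.card_range, smul_eq_mul,
    add_comm]
  intro i hi i' hi' hne
  rcases lt_or_gt_of_ne hne with h | h
  · exact hdisj i i' h (Finset.mem_range.1 hi')
  · exact (hdisj i' i h (Finset.mem_range.1 hi)).symm

end Intervals

/-! ### Critical sets of diagonal hypergraphs. -/

section Diagonal

variable {N k : ℕ}

lemma unrooted_noEdge_indicatorWord_iff {H : Hypergraph (Fin (N + 1))} {c : Fin (N + 1)}
    (hc : ∀ e ∈ H.edgeSet, c ∈ e) (A : Finset (Fin N)) :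
    unrooted (NoEdge H) c (indicatorWord A) ↔
      ∀ e ∈ H.edgeSet, ∃ v ∈ A, c.succAbove v ∈ e := by
  constructor
  · intro h e he
    by_contra! hA
    have hz : ∀ u ∈ e, insertZero c (indicatorWord A) u = 0 := by
      intro u
      refine c.succAboveCases ?_ (fun v => ?_) u
      · simp
      · intro hv
        rw [insertZero_succAbove, indicatorWord, if_neg fun hv' => hA v hv' hv]
    exact h e he fun u hu v hv => (hz u hu).trans (hz v hv).symm
  · intro h e he hconst
    obtain ⟨v, hv, hve⟩ := h e he
    have := hconst _ hve c (hc e he)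
    rw [insertZero_same, insertZero_succAbove, indicatorWord, if_pos hv] at this
    exact one_ne_zero this

/-- An interval starting at `i` contains `n - k`, where `n = N + 1`, since `i ≤ n - k < k ≤ i + k`.
-/
lemma mem_edge_diagonal (hk : k ≤ N + 1) (hn : N + 1 < 2 * k) (σ : Equiv.Perm (Fin (N + 1))) :
    ∀ e ∈ ((diagonal (N + 1) k).image σ).edgeSet, σ ⟨N + 1 - k, by omega⟩ ∈ e := by
  rintro _ ⟨_, ⟨i, hi, rfl⟩, rfl⟩
  refine ⟨⟨N + 1 - k, by omega⟩, ⟨?_, ?_⟩, rfl⟩ <;> dsimp only <;> omega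

/-- The sets of vertices other than `c` that meet every edge of a diagonal hypergraph, together
with the sets of vertices that miss an edge, are all sets of vertices other than `c`. -/
lemma card_criticalSets_diagonal (hk : k ≤ N + 1) (hn : N + 1 < 2 * k)
    (σ : Equiv.Perm (Fin (N + 1))) (p : ℕ) :
    (criticalSets (unrooted (NoEdge ((diagonal (N + 1) k).image σ))
        (σ ⟨N + 1 - k, by omega⟩)) p).card + (missingSets (N + 1) k p).card = N.choose p := by
  set c₀ : Fin (N + 1) := ⟨N + 1 - k, by omega⟩
  have hc : ∀ e ∈ ((diagonal (N + 1) k).image σ).edgeSet, σ c₀ ∈ e := mem_edge_diagonal hk hn σ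
  let ι : Fin N ↪ Fin (N + 1) :=
    ⟨fun v => σ.symm ((σ c₀).succAbove v),
      σ.symm.injective.comp Fin.succAbove_right_injective⟩
  have hι : ∀ x, x ≠ c₀ → ∃ v, ι v = x := fun x hx => by
    obtain ⟨v, hv⟩ := Fin.exists_succAbove_eq (x := σ x) (y := σ c₀) fun h => hx (σ.injective h)
    exact ⟨v, (σ.symm_apply_eq).2 hv⟩
  let P : Finset (Fin N) → Prop := fun B =>
    unrooted (NoEdge ((diagonal (N + 1) k).image σ)) (σ c₀) (indicatorWord B)
  have key : ∀ B, P B ↔ ¬ ∃ i, i + k ≤ N + 1 ∧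
      ∀ x ∈ B.map ι, ¬ (i ≤ (x : ℕ) ∧ (x : ℕ) < i + k) := by
    intro B
    refine (unrooted_noEdge_indicatorWord_iff hc B).trans ?_
    push Not
    constructor
    · intro h i hi
      obtain ⟨v, hv, x, hx, hxv⟩ := h _ ⟨_, ⟨i, hi, rfl⟩, rfl⟩
      refine ⟨ι v, Finset.mem_map_of_mem ι hv, ?_⟩
      rwa [show ι v = x from (σ.symm_apply_eq).2 hxv.symm]
    · rintro h _ ⟨_, ⟨i, hi, rfl⟩, rfl⟩
      obtain ⟨x, hx, hx'⟩ := h i hi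
      obtain ⟨v, hv, rfl⟩ := Finset.mem_map.1 hx
      exact ⟨v, hv, ι v, hx', σ.apply_symm_apply _⟩
  classical
  have h1 : criticalSets (unrooted (NoEdge ((diagonal (N + 1) k).image σ)) (σ c₀)) p =
      (Finset.powersetCard p Finset.univ).filter P := by
    ext B
    rw [mem_criticalSets, Finset.mem_filter, Finset.mem_powersetCard_univ]
  have h2 : missingSets (N + 1) k p = ((Finset.powersetCard p Finset.univ).filter
      fun B => ¬ P B).map (Finset.mapEmbedding ι).toEmbedding := by
    ext A
    rw [Finset.mem_map]
    simp only [missingSets, Finset.mem_filter, Finset.mem_powersetCard_univ, key, not_not,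
      Finset.mem_univ, true_and]
    constructor
    · rintro ⟨hA, i, hi, hA'⟩
      -- Every interval contains `c₀`, so a set missing one avoids `c₀` and is the image of a set in
      -- `Fin N`.
      have hcA : c₀ ∉ A := fun h => hA' c₀ h ⟨by simp only [c₀]; omega, by simp only [c₀]; omega⟩
      have hB : (Finset.univ.filter fun v => ι v ∈ A).map ι = A := by
        ext x
        simp only [Finset.mem_map, Finset.mem_filter, Finset.mem_univ, true_and]
        constructor
        · rintro ⟨v, hv, rfl⟩
          exact hv
        · intro hx
          obtain ⟨v, rfl⟩ := hι x fun h => hcA (h ▸ hx)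
          exact ⟨v, hx, rfl⟩
      refine ⟨_, ⟨?_, i, hi, ?_⟩, hB⟩
      · rw [← Finset.card_map ι, hB, hA]
      · rw [hB]
        exact hA'
    · rintro ⟨B, ⟨hB, h⟩, rfl⟩
      exact ⟨(Finset.card_map ι).trans hB, h⟩
  rw [h1, h2, Finset.card_map, Finset.card_filter_add_card_filter_not, Finset.card_powersetCard,
    Finset.card_univ, Fintype.card_fin]

end Diagonal

end CyclicColoring

end

/-! ### The two ranges of degrees. -/

theorem theorem5p1 (𝕜 : Type*) [Field 𝕜] [CharZero 𝕜] (n k : ℕ) (H : Hypergraph (Fin n))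
    (hH : CyclicColoring.IsDiagonal H k) (hk : ⌈(n : ℚ) / 2⌉ < (k : ℤ)) (r : ℕ) :
    ((r : ℤ) > (n : ℤ) - k - 1 →
      (Module.finrank 𝕜 (CyclicColoring.ComplHomology 𝕜 H r) : ℤ) = (n - 1).choose (r + 1)) ∧
    ((n : ℤ) - k - 1 ≥ (r : ℤ) →
      (Module.finrank 𝕜 (CyclicColoring.ComplHomology 𝕜 H r) : ℤ) =
        ((n - 1).choose (r + 1) : ℤ) - ((n : ℤ) - k) * ((n - k - 1).choose r : ℤ)
          - ((n - k).choose (r + 1) : ℤ)) := by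
  obtain ⟨hkn, σ, rfl⟩ := hH
  have hn : n < 2 * k := by
    have h : (n : ℚ) / 2 < k := (Int.le_ceil _).trans_lt (by exact_mod_cast hk)
    rw [div_lt_iff₀ two_pos, mul_comm] at h
    exact_mod_cast h
  obtain ⟨N, rfl⟩ : ∃ N, n = N + 1 := ⟨n - 1, by omega⟩
  have hcount := CyclicColoring.card_criticalSets_diagonal hkn hn σ (r + 1)
  rw [CyclicColoring.card_missingSets hkn hn,
    ← CyclicColoring.finrank_complHomology 𝕜 _ (CyclicColoring.mem_edge_diagonal hkn hn σ)] at hcount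
  rw [Nat.add_sub_cancel, ← hcount]
  constructor
  · intro hr
    have h1 : (N + 1 - k).choose (r + 1) = 0 := Nat.choose_eq_zero_of_lt (by omega)
    have h2 : (N + 1 - k) * (N + 1 - k - 1).choose r = 0 := by
      -- For `k = n` the truncated `n - k - 1` is `0` and the binomial coefficient may be `1`; then
      -- the factor `n - k` vanishes instead.
      rcases Nat.eq_zero_or_pos (N + 1 - k) with h | h
      · rw [h, zero_mul]
      · rw [Nat.choose_eq_zero_of_lt (n := N + 1 - k - 1) (k := r) (by omega), mul_zero]
    rw [h1, h2]
    simp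
  · intro _
    push_cast [Nat.cast_sub hkn]
    ring
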